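/- Let $K$ be a locally compact separable metrizable space and $\mu$ a positive Radon measure on $K$ with full support. Let $(\mathcal E,\mathcal F)$ be a strongly local regular symmetric Dirichlet form on $L^2(K,\mu)$; the space $\mathcal F$ is a Hilbert space with the inner product $\mathcal E(f,g)+\int_K fg\,d\mu$, and functions in $\mathcal F$ are taken in quasi-continuous modifications. Strong locality means that $\mathcal E(u,v)=0$ whenever $u,v\in\mathcal F$ and $v$ is constant on a neighborhood of the support of $|u|\,d\mu$. Let $\nu$ be a minimal energy-dominant measure, that is, a Borel measure on $K$ such that the energy measure $\nu_f$ of every $f\in\mathcal F$ is absolutely continuous with respect to $\nu$, and such that $\nu\ll\nu'$ for every Borel measure $\nu'$ with the same property. A function $h\in\mathcal F$ is called harmonic on an open set $U\subset K$ if $\mathcal E(h,h)\le\mathcal E(f,f)$ for every $f\in\mathcal F$ with $f=h$ quasi-everywhere on $K\setminus U$ (that is, outside a set of zero $1$-capacity). A partition of $K$ is a family of pairwise disjoint, relatively compact open subsets of $K$ whose union has a $(\mu+\nu)$-null complement. Let $\{U^{(n)}_k\}_{k\in\Lambda_n}$, $n\in\mathbb N$, be a sequence of partitions of $K$ such that (a)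 for every $n$ and every $k\in\Lambda_{n+1}$ there is $k'\in\Lambda_n$ with $U^{(n+1)}_k\subset U^{(n)}_{k'}$; (b) for every Borel set $A\subset K$ there is a set $A'$ in the $\sigma$-field generated by all the sets $U^{(n)}_k$ ($n\in\mathbb N$, $k\in\Lambda_n$) such that $(\mu+\nu)(A\mathbin{\triangle}A')=0$; (c) for every compact set $S\subset K$ there is $n\in\mathbb N$ such that $\mu\bigl(\bigcup_{k\in\Lambda_n,\;U^{(n)}_k\cap S\neq\emptyset}U^{(n)}_k\bigr)<\infty$. Let $\mathcal H_n$ be the set of all $h\in\mathcal F$ that are harmonic on $U^{(n)}_k$ for every $k\in\Lambda_n$, and let $\mathcal H_*=\bigcup_{n\in\mathbb N}\mathcal H_n$. Then $\mathcal H_*\cap L^\infty(K,\mu)$ is dense in $\mathcal F$. -/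

import Mathlib

open MeasureTheory Filter Topology Set
open scoped ENNReal CompactlySupported symmDiff

section DirichletForms

/-- A symmetric Dirichlet form on `L²(K, μ)`. Elements of the domain are `μ`-classes. -/
structure DirichletForm {K : Type*} [MeasurableSpace K] (μ : Measure K) where
  /-- the domain, written `F` in the comments below -/
  domain : Submodule ℝ (Lp ℝ 2 μ)
  /-- the bilinear form, written `E` in the comments below -/
  form : domain →ₗ[ℝ] domain →ₗ[ℝ] ℝ
  dense_domain : Dense (domain : Set (Lp ℝ 2 μ))
  form_symm : ∀ f g : domain, form f g = form g f
  form_nonneg : ∀ f : domain, 0 ≤ form f f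
  /-- closedness: `F` is complete for the norm whose square is `E(f, f) + ∫ f² dμ` -/
  closed : ∀ u : ℕ → domain,
    (∀ ε : ℝ, 0 < ε → ∃ N : ℕ, ∀ m ≥ N, ∀ n ≥ N,
      form (u m - u n) (u m - u n)
        + ∫ x, (((u m - u n : domain) : Lp ℝ 2 μ) : K → ℝ) x ^ 2 ∂μ < ε) →
    ∃ f : domain, Tendsto (fun n => form (u n - f) (u n - f)
        + ∫ x, (((u n - f : domain) : Lp ℝ 2 μ) : K → ℝ) x ^ 2 ∂μ) atTop (𝓝 0)
  markov : ∀ f : domain, ∃ g : domain,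
    (((g : Lp ℝ 2 μ) : K → ℝ) =ᵐ[μ] fun x => min (max 0 (((f : Lp ℝ 2 μ) : K → ℝ) x)) 1) ∧
      form g g ≤ form f f

namespace DirichletForm

/-- A representative of the class `f ∈ F`. -/
noncomputable def rep {K : Type*} [MeasurableSpace K] {μ : Measure K} (D : DirichletForm μ)
    (f : D.domain) : K → ℝ :=
  ((f : Lp ℝ 2 μ) : K → ℝ)

/-- The square `E(f, f) + ∫ f² dμ` of the norm of `F`. -/
noncomputable def normSq {K : Type*} [MeasurableSpace K] {μ : Measure K} (D : DirichletForm μ)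
    (f : D.domain) : ℝ :=
  D.form f f + ∫ x, D.rep f x ^ 2 ∂μ

/-- `S` is dense in the Hilbert space `F`. -/
def IsDense {K : Type*} [MeasurableSpace K] {μ : Measure K} (D : DirichletForm μ)
    (S : Set D.domain) : Prop :=
  ∀ f : D.domain, ∀ ε : ℝ, 0 < ε → ∃ g ∈ S, √(D.normSq (f - g)) < ε

/-- Regularity: `F ∩ C_c(K)` is dense in `F` and, uniformly, in `C_c(K)`. -/
structure IsRegular {K : Type*} [TopologicalSpace K] [MeasurableSpace K] {μ : Measure K}
    (D : DirichletForm μ) : Prop where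
  dense_domain : D.IsDense {g | ∃ φ : C_c(K, ℝ), D.rep g =ᵐ[μ] φ}
  dense_cc : ∀ φ : C_c(K, ℝ), ∀ ε : ℝ, 0 < ε → ∃ ψ : C_c(K, ℝ),
    (∃ g : D.domain, D.rep g =ᵐ[μ] ψ) ∧ ∀ x, |φ x - ψ x| < ε

/-- The support of the measure `|u| dμ`. -/
def supp {K : Type*} [TopologicalSpace K] [MeasurableSpace K] {μ : Measure K}
    (D : DirichletForm μ) (u : D.domain) : Set K :=
  {x | ∀ U ∈ 𝓝 x, 0 < ∫⁻ y in U, ‖D.rep u y‖ₑ ∂μ}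

/-- Strong locality. -/
def IsStronglyLocal {K : Type*} [TopologicalSpace K] [MeasurableSpace K] {μ : Measure K}
    (D : DirichletForm μ) : Prop :=
  ∀ u v : D.domain,
    (∃ (O : Set K) (c : ℝ), IsOpen O ∧ D.supp u ⊆ O ∧ ∀ᵐ x ∂μ, x ∈ O → D.rep v x = c) →
    D.form u v = 0

/-- The `1`-capacity of a subset of `K`. -/
noncomputable def cap {K : Type*} [TopologicalSpace K] [MeasurableSpace K] {μ : Measure K}
    (D : DirichletForm μ) (A : Set K) : ℝ≥0∞ :=
  ⨅ (f : D.domain) (_ : ∃ O : Set K, IsOpen O ∧ A ⊆ O ∧ ∀ᵐ x ∂μ, x ∈ O → 1 ≤ D.rep f x),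
    ENNReal.ofReal (D.normSq f)

/-- Quasi-continuity of a function on `K`. -/
def IsQuasiContinuous {K : Type*} [TopologicalSpace K] [MeasurableSpace K] {μ : Measure K}
    (D : DirichletForm μ) (f : K → ℝ) : Prop :=
  ∀ ε : ℝ≥0∞, 0 < ε → ∃ G : Set K, IsOpen G ∧ D.cap G < ε ∧ ContinuousOn f Gᶜ

/-- `f = g` quasi-everywhere on `A`, for `f, g ∈ F` taken in quasi-continuous modifications
(these exist and are unique up to sets of zero capacity when the form is regular). -/
def EqQEOn {K : Type*} [TopologicalSpace K] [MeasurableSpace K] {μ : Measure K}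
    (D : DirichletForm μ) (f g : D.domain) (A : Set K) : Prop :=
  ∃ f' g' : K → ℝ, D.IsQuasiContinuous f' ∧ D.IsQuasiContinuous g' ∧
    D.rep f =ᵐ[μ] f' ∧ D.rep g =ᵐ[μ] g' ∧ D.cap {x ∈ A | f' x ≠ g' x} = 0

/-- `h ∈ F` is harmonic on `U`: it minimizes `E(f, f)` among all `f ∈ F` with `f = h`
quasi-everywhere on `K ∖ U`. -/
def IsHarmonicOn {K : Type*} [TopologicalSpace K] [MeasurableSpace K] {μ : Measure K}
    (D : DirichletForm μ) (h : D.domain) (U : Set K) : Prop :=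
  ∀ f : D.domain, D.EqQEOn f h Uᶜ → D.form h h ≤ D.form f f

/-- `κ` is the energy measure of the bounded function `f ∈ F`: it is finite and
`∫ φ dκ = 2 E(f φ, f) - E(φ, f²)` for all `φ ∈ F ∩ C_c(K)`. -/
def IsEnergyMeasureOfBounded {K : Type*} [TopologicalSpace K] [MeasurableSpace K]
    {μ : Measure K} (D : DirichletForm μ) (f : D.domain) (κ : Measure K) : Prop :=
  IsFiniteMeasure κ ∧ ∀ (φ : C_c(K, ℝ)) (w : D.domain), D.rep w =ᵐ[μ] φ →
    ∃ p q : D.domain, (D.rep p =ᵐ[μ] fun x => D.rep f x * φ x) ∧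
      (D.rep q =ᵐ[μ] fun x => D.rep f x ^ 2) ∧
      ∫ x, φ x ∂κ = 2 * D.form p f - D.form w q

/-- `κ` is the energy measure of `f ∈ F`: the setwise limit of the energy measures of the
truncations `(-n) ∨ f ∧ n`. -/
def IsEnergyMeasure {K : Type*} [TopologicalSpace K] [MeasurableSpace K]
    {μ : Measure K} (D : DirichletForm μ) (f : D.domain) (κ : Measure K) : Prop :=
  ∃ (u : ℕ → D.domain) (κ' : ℕ → Measure K),
    (∀ n : ℕ, D.rep (u n) =ᵐ[μ] fun x => max (-(n : ℝ)) (min (D.rep f x) n)) ∧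
    (∀ n : ℕ, D.IsEnergyMeasureOfBounded (u n) (κ' n)) ∧
    ∀ B : Set K, MeasurableSet B → Tendsto (fun n => κ' n B) atTop (𝓝 (κ B))

/-- Every energy measure is absolutely continuous with respect to `ν`. -/
def IsEnergyDominant {K : Type*} [TopologicalSpace K] [MeasurableSpace K]
    {μ : Measure K} (D : DirichletForm μ) (ν : Measure K) : Prop :=
  ∀ (f : D.domain) (κ : Measure K), D.IsEnergyMeasure f κ → κ ≪ ν

/-- `ν` is a minimal energy-dominant measure. -/
def IsMinimalEnergyDominant {K : Type*} [TopologicalSpace K] [MeasurableSpace K]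
    {μ : Measure K} (D : DirichletForm μ) (ν : Measure K) : Prop :=
  D.IsEnergyDominant ν ∧ ∀ ν' : Measure K, D.IsEnergyDominant ν' → ν ≪ ν'

end DirichletForm

/-- A partition of `K` up to `(μ + ν)`-null sets into disjoint relatively compact open sets. -/
structure IsCellPartition {K : Type*} [TopologicalSpace K] [MeasurableSpace K]
    (μ ν : Measure K) {ι : Type*} (U : ι → Set K) : Prop where
  isOpen : ∀ k, IsOpen (U k)
  isCompact_closure : ∀ k, IsCompact (closure (U k))
  disjoint : ∀ k l, k ≠ l → Disjoint (U k) (U l)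
  null_compl : (μ + ν) (⋃ k, U k)ᶜ = 0

/-- A refining and generating sequence of partitions, locally of finite measure. -/
structure IsCellPartitionSequence {K : Type*} [TopologicalSpace K] [MeasurableSpace K]
    (μ ν : Measure K) {Λ : ℕ → Type*} (U : (n : ℕ) → Λ n → Set K) : Prop where
  partition : ∀ n, IsCellPartition μ ν (U n)
  refine : ∀ n, ∀ k : Λ (n + 1), ∃ k' : Λ n, U (n + 1) k ⊆ U n k'
  generate : ∀ A : Set K, MeasurableSet A → ∃ A' : Set K,
    MeasurableSet[MeasurableSpace.generateFrom {s | ∃ (n : ℕ) (k : Λ n), s = U n k}] A' ∧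
      (μ + ν) (A ∆ A') = 0
  finite : ∀ S : Set K, IsCompact S → ∃ n : ℕ,
    μ (⋃ k ∈ {k : Λ n | (U n k ∩ S).Nonempty}, U n k) < ∞

/-- The functions in `F` that are harmonic on every cell of the `n`-th partition. -/
def DirichletForm.harmonicLevel {K : Type*} [TopologicalSpace K] [MeasurableSpace K]
    {μ : Measure K} (D : DirichletForm μ) {Λ : ℕ → Type*} (U : (n : ℕ) → Λ n → Set K)
    (n : ℕ) : Set D.domain :=
  {h | ∀ k : Λ n, D.IsHarmonicOn h (U n k)}

/-- The functions in `F` that are harmonic on every cell of some partition. -/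
def DirichletForm.harmonicStar {K : Type*} [TopologicalSpace K] [MeasurableSpace K]
    {μ : Measure K} (D : DirichletForm μ) {Λ : ℕ → Type*} (U : (n : ℕ) → Λ n → Set K) :
    Set D.domain :=
  ⋃ n, D.harmonicLevel U n

end DirichletForms

/-! It suffices to approximate a nonnegative `f` in the domain that is continuous with compact
support `S`, since regularity makes differences of such functions dense. Let `W n` be the union of
the level-`n` cells meeting `S`. Minimizing the energy over `0 ≤ h ≤ M` with `f - h ∈ F0 (W n)`
gives `h n` (`exists_minimizer`). It is orthogonal for the form to `F0` of every level-`n` cell: by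
minimality for cells in `W n`, by strong locality for the others, where `h n` vanishes. The energies
are at most that of `f` and `W n` has finite measure from some level on, so the `h n` are bounded in
the Hilbert norm and have a weak limit `y` in the closure of the bounded harmonic functions.

The difference `f - y` lies in `V = ⋂ n, F0 (W n)` (`nullSpace`). It need not be shown to vanish:
bounded elements of `V` carry no energy (`E_bounded_eq_zero`), so `f - y` is itself harmonic on
every cell and `f = (f - y) + y` is in the closure.

Absence of energy comes from a splitting property. By strong locality the reflection `1_A - 1_{Aᶜ}`
preserves `V` and the energy when `A` is a cell, and since cells generate, this extends to all Borel
`A` (`reflectionInvariant_nullSpace`). Hence pieces of an element of `V` over disjoint Borel sets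
are orthogonal. Take an indicator function in `V`, cut down to a compact set, and slice it along
levels of a continuous `φ` at spacing `δ`. Near each slice `b`, `φ` is constant up to order `δ`, so
`abs_E_indicator_le` gives `|E(b, φ)| ≤ 4δ E(b, b)`; orthogonality sums this to `4δ` times a fixed
energy, and `δ → 0` (`E_indicator_core_eq_zero`). General bounded functions are limits of sums of
multiples of indicators.

Harmonicity is stated with quasi-everywhere boundary values; spectral synthesis
(`sub_mem_F0_of_eqQEOn`) deduces it from orthogonality to `F0`. -/

/-! ### Weak limits, in the form of closed convex sets -/

/-- A bounded sequence in a Hilbert space has a point which belongs to every closed convex set that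
eventually contains the sequence. -/
theorem exists_mem_of_eventually_mem_closed_convex {H : Type*} [NormedAddCommGroup H]
    [InnerProductSpace ℝ H] [CompleteSpace H] (x : ℕ → H) (C : ℝ) (hx : ∀ n, ‖x n‖ ≤ C) :
    ∃ y, ∀ S : Set H, IsClosed S → Convex ℝ S → (∀ᶠ n in atTop, x n ∈ S) → y ∈ S := by
  -- A closed convex set that eventually contains the sequence contains some `T n`, so a point
  -- common to all `T n` is enough. The points of least norm of the `T n` have increasing bounded
  -- norms; the parallelogram law, applied to midpoints, makes them Cauchy.
  let T : ℕ → Set H := fun n => closure (convexHull ℝ (x '' Ici n))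
  have hTc : ∀ n, IsClosed (T n) := fun n => isClosed_closure
  have hTv : ∀ n, Convex ℝ (T n) := fun n => (convex_convexHull ℝ _).closure
  have hxT : ∀ n, ∀ k ≥ n, x k ∈ T n := fun n k hk =>
    subset_closure (subset_convexHull ℝ _ ⟨k, hk, rfl⟩)
  have hTmin : ∀ n (S : Set H), IsClosed S → Convex ℝ S → (∀ k ≥ n, x k ∈ S) → T n ⊆ S := by
    intro n S hS hS' h
    refine closure_minimal (convexHull_min ?_ hS') hS
    rintro _ ⟨k, hk, rfl⟩
    exact h k hk
  have hanti : ∀ n m, n ≤ m → T m ⊆ T n := fun n m hnm =>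
    hTmin m _ (hTc n) (hTv n) fun k hk => hxT n k (hnm.trans hk)
  have hmin : ∀ n, ∃ p ∈ T n, ∀ w ∈ T n, ‖p‖ ≤ ‖w‖ := by
    intro n
    obtain ⟨p, hp, hp'⟩ := exists_norm_eq_iInf_of_complete_convex (K := T n)
      ⟨x n, hxT n n le_rfl⟩ (hTc n).isComplete (hTv n) (0 : H)
    refine ⟨p, hp, fun w hw => ?_⟩
    have h := ciInf_le (f := fun w : T n => ‖(0 : H) - w‖)
      ⟨0, by rintro _ ⟨w, rfl⟩; exact norm_nonneg _⟩ ⟨w, hw⟩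
    rw [← hp'] at h
    simpa using h
  choose p hpT hpmin using hmin
  have hmono : Monotone fun n => ‖p n‖ ^ 2 := fun n m hnm =>
    pow_le_pow_left₀ (norm_nonneg _) (hpmin n _ (hanti n m hnm (hpT m))) 2
  have hbdd : BddAbove (range fun n => ‖p n‖ ^ 2) := by
    refine ⟨C ^ 2, ?_⟩
    rintro _ ⟨n, rfl⟩
    exact pow_le_pow_left₀ (norm_nonneg _)
      ((hpmin n _ (hxT n n le_rfl)).trans (hx n)) 2
  have hcs : CauchySeq fun n => ‖p n‖ ^ 2 := (tendsto_atTop_ciSup hmono hbdd).cauchySeq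
  have key : ∀ n m, n ≤ m → ‖p n - p m‖ ^ 2 ≤ 2 * (‖p m‖ ^ 2 - ‖p n‖ ^ 2) := by
    intro n m hnm
    have hmid : (1 / 2 : ℝ) • p n + (1 / 2 : ℝ) • p m ∈ T n :=
      hTv n (hpT n) (hanti n m hnm (hpT m)) (by norm_num) (by norm_num) (by norm_num)
    have h1 := hpmin n _ hmid
    rw [← smul_add, norm_smul] at h1
    norm_num at h1
    have h2 := parallelogram_law_with_norm ℝ (p n) (p m)
    nlinarith [norm_nonneg (p n), norm_nonneg (p n + p m)]
  have hpc : CauchySeq p := by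
    rw [Metric.cauchySeq_iff']
    intro ε hε
    obtain ⟨N, hN⟩ := Metric.cauchySeq_iff'.1 hcs (ε ^ 2 / 2) (by positivity)
    refine ⟨N, fun n hn => ?_⟩
    have h1 := key N n hn
    have h2 := hN n hn
    rw [Real.dist_eq] at h2
    have h3 := (abs_lt.1 h2).2
    rw [dist_comm, dist_eq_norm]
    exact lt_of_pow_lt_pow_left₀ 2 hε.le (by linarith)
  obtain ⟨y, hy⟩ := cauchySeq_tendsto_of_complete hpc
  refine ⟨y, fun S hS hS' h => ?_⟩
  obtain ⟨N, hN⟩ := eventually_atTop.1 h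
  refine hTmin N S hS hS' hN ((hTc N).mem_of_tendsto hy ?_)
  filter_upwards [eventually_ge_atTop N] with n hn using hanti N n hn (hpT n)

/-! ### The domain as a Hilbert space -/

namespace DirichletForm

section Hilbert

variable {K : Type*} [MeasurableSpace K] {μ : Measure K}

/-- The domain of a Dirichlet form, to be equipped with its Hilbert space norm. -/
def Dom (D : DirichletForm μ) : Type _ := D.domain

variable (D : DirichletForm μ)

noncomputable instance : AddCommGroup D.Dom := inferInstanceAs (AddCommGroup D.domain)

noncomputable instance : Module ℝ D.Dom := inferInstanceAs (Module ℝ D.domain)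

/-- The form as a bilinear map on `D.Dom`. -/
noncomputable def E : D.Dom →ₗ[ℝ] D.Dom →ₗ[ℝ] ℝ := D.form

/-- The inclusion of the domain into `L²`. -/
noncomputable def toLp : D.Dom →ₗ[ℝ] Lp ℝ 2 μ := D.domain.subtype

/-- A representative of an element of the domain. -/
noncomputable def fn (u : D.Dom) : K → ℝ := D.rep u

theorem E_comm (u v : D.Dom) : D.E u v = D.E v u := D.form_symm u v

theorem E_nonneg (u : D.Dom) : 0 ≤ D.E u u := D.form_nonneg u

theorem toLp_injective : Function.Injective D.toLp := Subtype.coe_injective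

theorem fn_eq (u : D.Dom) : D.fn u = (D.toLp u : K → ℝ) := rfl

/-- The inner product of the domain. -/
@[reducible] noncomputable def innerCore : InnerProductSpace.Core ℝ D.Dom where
  inner f g := D.E f g + inner ℝ (D.toLp f) (D.toLp g)
  conj_inner_symm f g := by
    simp only [conj_trivial]
    rw [D.E_comm, real_inner_comm]
  re_inner_nonneg f := by
    simpa using add_nonneg (D.E_nonneg f) real_inner_self_nonneg
  add_left f g h := by
    simp only [map_add, LinearMap.add_apply, inner_add_left]
    ring
  smul_left f g r := by
    simp only [map_smul, LinearMap.smul_apply, real_inner_smul_left, smul_eq_mul, conj_trivial]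
    ring
  definite f h := by
    have h1 := D.E_nonneg f
    have h2 : 0 ≤ inner ℝ (D.toLp f) (D.toLp f) := real_inner_self_nonneg
    have h3 : inner ℝ (D.toLp f) (D.toLp f) = 0 := by linarith
    exact D.toLp_injective (by rw [inner_self_eq_zero.1 h3, map_zero])

noncomputable instance : NormedAddCommGroup D.Dom := D.innerCore.toNormedAddCommGroup

noncomputable instance : InnerProductSpace ℝ D.Dom := InnerProductSpace.ofCore D.innerCore.toCore

theorem norm_sq (u : D.Dom) : ‖u‖ ^ 2 = D.E u u + ‖D.toLp u‖ ^ 2 := by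
  rw [← real_inner_self_eq_norm_sq, ← real_inner_self_eq_norm_sq]
  rfl

theorem norm_toLp_sq (u : D.Dom) : ‖D.toLp u‖ ^ 2 = ∫ x, D.fn u x ^ 2 ∂μ := by
  rw [← real_inner_self_eq_norm_sq, L2.inner_def]
  simp [fn_eq, sq]

theorem normSq_eq (u : D.Dom) : D.normSq u = ‖u‖ ^ 2 := by
  rw [norm_sq, norm_toLp_sq]
  rfl

theorem norm_toLp_le (u : D.Dom) : ‖D.toLp u‖ ≤ ‖u‖ := by
  refine le_of_sq_le_sq ?_ (norm_nonneg _)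
  rw [norm_sq]
  linarith [D.E_nonneg u]

theorem E_le_norm_sq (u : D.Dom) : D.E u u ≤ ‖u‖ ^ 2 := by
  rw [norm_sq]
  linarith [sq_nonneg ‖D.toLp u‖]

theorem norm_le_of_le {u v : D.Dom} (h : D.E u u ≤ D.E v v) (h' : ‖D.toLp u‖ ≤ ‖D.toLp v‖) :
    ‖u‖ ≤ ‖v‖ := by
  refine le_of_sq_le_sq ?_ (norm_nonneg _)
  rw [norm_sq, norm_sq]
  gcongr

theorem continuous_toLp : Continuous D.toLp :=
  AddMonoidHomClass.continuous_of_bound D.toLp 1 fun u => by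
    simpa using D.norm_toLp_le u

theorem E_cauchy_schwarz (u v : D.Dom) : D.E u v ^ 2 ≤ D.E u u * D.E v v := by
  have h : ∀ t : ℝ, 0 ≤ D.E v v * (t * t) + (2 * D.E u v) * t + D.E u u := by
    intro t
    have h1 := D.E_nonneg (u + t • v)
    simp only [map_add, map_smul, LinearMap.add_apply, LinearMap.smul_apply, smul_eq_mul] at h1
    rw [D.E_comm v u] at h1
    linarith
  have := discrim_le_zero h
  rw [discrim] at this
  linarith

theorem E_eq_zero_of_self {u : D.Dom} (h : D.E u u = 0) (v : D.Dom) : D.E u v = 0 := by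
  have h1 := D.E_cauchy_schwarz u v
  rw [h, zero_mul] at h1
  exact pow_eq_zero_iff (two_ne_zero) |>.1 (le_antisymm h1 (sq_nonneg _))

theorem abs_E_le (u v : D.Dom) : |D.E u v| ≤ ‖u‖ * ‖v‖ := by
  refine abs_le_of_sq_le_sq ?_ (by positivity)
  rw [mul_pow]
  exact (D.E_cauchy_schwarz u v).trans
    (mul_le_mul (D.E_le_norm_sq u) (D.E_le_norm_sq v) (D.E_nonneg v) (sq_nonneg _))

theorem continuous_E : Continuous fun p : D.Dom × D.Dom => D.E p.1 p.2 := by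
  have h : ∀ p : D.Dom × D.Dom, D.E p.1 p.2
      = (LinearMap.mkContinuous₂ D.E 1 fun u v => by
          simpa using D.abs_E_le u v) p.1 p.2 := fun p => rfl
  simp_rw [h]
  fun_prop

theorem continuous_E_left (v : D.Dom) : Continuous fun u => D.E u v :=
  D.continuous_E.comp (continuous_id.prodMk continuous_const)

theorem continuous_E_right (u : D.Dom) : Continuous fun v => D.E u v :=
  D.continuous_E.comp (continuous_const.prodMk continuous_id)

theorem continuous_E_self : Continuous fun u : D.Dom => D.E u u :=
  D.continuous_E.comp (continuous_id.prodMk continuous_id)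

theorem E_add_self (u v : D.Dom) : D.E (u + v) (u + v) = D.E u u + 2 * D.E u v + D.E v v := by
  simp only [map_add, LinearMap.add_apply]
  rw [D.E_comm v u]
  ring

theorem E_sub_self (u v : D.Dom) : D.E (u - v) (u - v) = D.E u u - 2 * D.E u v + D.E v v := by
  simp only [map_sub, LinearMap.sub_apply]
  rw [D.E_comm v u]
  ring

theorem E_smul_self (c : ℝ) (u : D.Dom) : D.E (c • u) (c • u) = c ^ 2 * D.E u u := by
  simp only [map_smul, LinearMap.smul_apply, smul_eq_mul]
  ring

theorem E_neg_self (u : D.Dom) : D.E (-u) (-u) = D.E u u := by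
  simp

/-- The convexity defect of the energy is `s t E(u - v, u - v) ≥ 0`. With `isClosed_E_le` this plays
the role of weak lower semicontinuity of the energy. -/
theorem convex_E_le (a : ℝ) : Convex ℝ {u : D.Dom | D.E u u ≤ a} := by
  intro u hu v hv s t hs ht hst
  have h0 := D.E_nonneg (u - v)
  rw [E_sub_self] at h0
  simp only [mem_ofPred_eq] at *
  rw [E_add_self, E_smul_self, E_smul_self]
  simp only [map_smul, LinearMap.smul_apply, smul_eq_mul]
  have : s ^ 2 * D.E u u + 2 * (s * (t * D.E u v)) + t ^ 2 * D.E v v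
      ≤ s * D.E u u + t * D.E v v := by
    have hs' : s = 1 - t := by linarith
    subst hs'
    nlinarith [mul_nonneg (mul_nonneg hs ht) h0]
  calc _ = s ^ 2 * D.E u u + 2 * (s * (t * D.E u v)) + t ^ 2 * D.E v v := by ring
    _ ≤ s * D.E u u + t * D.E v v := this
    _ ≤ s * a + t * a := by gcongr
    _ = a := by rw [← add_mul, hst, one_mul]

theorem isClosed_E_le (a : ℝ) : IsClosed {u : D.Dom | D.E u u ≤ a} :=
  isClosed_le D.continuous_E_self continuous_const

instance : CompleteSpace D.Dom := by
  refine Metric.complete_of_cauchySeq_tendsto fun u hu => ?_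
  have key : ∀ w : D.Dom, D.form w w + ∫ x, (((show D.domain from w) : Lp ℝ 2 μ) : K → ℝ) x ^ 2 ∂μ
      = ‖w‖ ^ 2 := fun w => D.normSq_eq w
  obtain ⟨f, h1⟩ : ∃ f : D.Dom, Tendsto (fun n => ‖u n - f‖ ^ 2) atTop (𝓝 0) := by
    obtain ⟨f, hf⟩ := D.closed u (by
      intro ε hε
      obtain ⟨N, hN⟩ := Metric.cauchySeq_iff.1 hu (√ε) (by positivity)
      refine ⟨N, fun m hm n hn => ?_⟩
      refine (key (u m - u n)).trans_lt ?_
      have := hN m hm n hn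
      rw [dist_eq_norm] at this
      exact (Real.lt_sqrt (norm_nonneg _)).1 this)
    exact ⟨f, hf.congr fun n => D.normSq_eq (u n - show D.Dom from f)⟩
  refine ⟨f, ?_⟩
  rw [tendsto_iff_norm_sub_tendsto_zero]
  have h2 := (Real.continuous_sqrt.tendsto 0).comp h1
  rw [Real.sqrt_zero] at h2
  refine h2.congr fun n => ?_
  simp [Real.sqrt_sq]

end Hilbert

end DirichletForm

/-! ### Lattice operations on the domain -/

namespace DirichletForm

section Lattice

variable {K : Type*} [MeasurableSpace K] {μ : Measure K} (D : DirichletForm μ)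

theorem fn_add (u v : D.Dom) : D.fn (u + v) =ᵐ[μ] fun x => D.fn u x + D.fn v x := by
  simp only [fn_eq, map_add]
  exact Lp.coeFn_add _ _

theorem fn_sub (u v : D.Dom) : D.fn (u - v) =ᵐ[μ] fun x => D.fn u x - D.fn v x := by
  simp only [fn_eq, map_sub]
  exact Lp.coeFn_sub _ _

theorem fn_neg (u : D.Dom) : D.fn (-u) =ᵐ[μ] fun x => -D.fn u x := by
  simp only [fn_eq, map_neg]
  exact Lp.coeFn_neg _

theorem fn_smul (c : ℝ) (u : D.Dom) : D.fn (c • u) =ᵐ[μ] fun x => c * D.fn u x := by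
  simp only [fn_eq, map_smul]
  exact Lp.coeFn_smul _ _

theorem fn_zero : D.fn 0 =ᵐ[μ] fun _ => 0 := by
  simp only [fn_eq, map_zero]
  exact Lp.coeFn_zero _ _ _

variable {D}

theorem ext_fn {u v : D.Dom} (h : D.fn u =ᵐ[μ] D.fn v) : u = v :=
  D.toLp_injective (Lp.ext h)

variable (D)

theorem memLp_fn (u : D.Dom) : MemLp (D.fn u) 2 μ := Lp.memLp _

theorem aestronglyMeasurable_fn (u : D.Dom) : AEStronglyMeasurable (D.fn u) μ :=
  (D.memLp_fn u).1

theorem norm_toLp_le_of_ae {u v : D.Dom} (h : ∀ᵐ x ∂μ, |D.fn u x| ≤ |D.fn v x|) :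
    ‖D.toLp u‖ ≤ ‖D.toLp v‖ :=
  Lp.norm_le_norm_of_ae_le h

/-- Norm convergence implies `L²` convergence, hence almost everywhere convergence along a
subsequence. -/
theorem isClosed_ae_mem (S : K → Set ℝ) (hS : ∀ x, IsClosed (S x)) :
    IsClosed {u : D.Dom | ∀ᵐ x ∂μ, D.fn u x ∈ S x} := by
  refine IsSeqClosed.isClosed fun w u hw hu => ?_
  have h1 : Tendsto (fun n => D.toLp (w n)) atTop (𝓝 (D.toLp u)) :=
    (D.continuous_toLp.tendsto u).comp hu
  obtain ⟨ns, -, hns⟩ := (tendstoInMeasure_of_tendsto_Lp h1).exists_seq_tendsto_ae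
  have h2 : ∀ᵐ x ∂μ, ∀ n, D.fn (w n) x ∈ S x := ae_all_iff.2 hw
  simp only [mem_ofPred_eq]
  filter_upwards [hns, h2] with x hx hx2
  exact (hS x).mem_of_tendsto hx (Eventually.of_forall fun i => hx2 _)

theorem convex_ae_mem (S : K → Set ℝ) (hS : ∀ x, Convex ℝ (S x)) :
    Convex ℝ {u : D.Dom | ∀ᵐ x ∂μ, D.fn u x ∈ S x} := by
  intro u hu v hv s t hs ht hst
  simp only [mem_ofPred_eq] at *
  filter_upwards [hu, hv, D.fn_add (s • u) (t • v), D.fn_smul s u, D.fn_smul t v]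
    with x h1 h2 h3 h4 h5
  rw [h3, h4, h5]
  exact hS x h1 h2 hs ht hst

/-- Bounded sequences of the domain that converge in `L²` converge, in the sense of closed convex
sets, to an element of the domain. -/
theorem exists_limit (x : ℕ → D.Dom) (C : ℝ) (hx : ∀ n, ‖x n‖ ≤ C) {g : Lp ℝ 2 μ}
    (h : Tendsto (fun n => D.toLp (x n)) atTop (𝓝 g)) :
    ∃ y : D.Dom, D.toLp y = g ∧
      ∀ S : Set D.Dom, IsClosed S → Convex ℝ S → (∀ᶠ n in atTop, x n ∈ S) → y ∈ S := by
  obtain ⟨y, hy⟩ := exists_mem_of_eventually_mem_closed_convex x C hx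
  refine ⟨y, ?_, hy⟩
  -- Preimages of closed `L²` balls around `g` are closed and convex, which pins down the image of
  -- `y`.
  have h1 : ∀ ε : ℝ, 0 < ε → dist (D.toLp y) g ≤ ε := by
    intro ε hε
    refine hy (D.toLp ⁻¹' Metric.closedBall g ε) (Metric.isClosed_closedBall.preimage D.continuous_toLp)
      ((convex_closedBall g ε).linear_preimage D.toLp) ?_
    exact h (Metric.closedBall_mem_nhds g hε)
  exact dist_le_zero.1 (le_of_forall_gt_imp_ge_of_dense h1)

theorem exists_limit_of_dominated (x : ℕ → D.Dom) (C : ℝ) (hx : ∀ n, ‖x n‖ ≤ C) {g : K → ℝ}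
    (d : D.Dom) (hd : ∀ n, ∀ᵐ t ∂μ, |D.fn (x n) t| ≤ |D.fn d t|)
    (h : ∀ᵐ t ∂μ, Tendsto (fun n => D.fn (x n) t) atTop (𝓝 (g t))) :
    ∃ y : D.Dom, D.fn y =ᵐ[μ] g ∧
      ∀ S : Set D.Dom, IsClosed S → Convex ℝ S → (∀ᶠ n in atTop, x n ∈ S) → y ∈ S := by
  have hgm : AEStronglyMeasurable g μ :=
    aestronglyMeasurable_of_tendsto_ae atTop (fun n => D.aestronglyMeasurable_fn (x n)) h
  have hd' := ae_all_iff.2 hd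
  have hgd : ∀ᵐ t ∂μ, |g t| ≤ |D.fn d t| := by
    filter_upwards [h, hd'] with t ht htd
    exact le_of_tendsto ht.abs (Eventually.of_forall htd)
  have hg : MemLp g 2 μ := (D.memLp_fn d).mono hgm hgd
  have hlim : Tendsto (fun n => D.toLp (x n)) atTop (𝓝 (hg.toLp g)) := by
    rw [tendsto_iff_norm_sub_tendsto_zero]
    have h0 : Tendsto (fun n => ∫ t, (D.fn (x n) t - g t) ^ 2 ∂μ) atTop (𝓝 (∫ _, (0 : ℝ) ∂μ)) := by
      refine tendsto_integral_of_dominated_convergence (fun t => 4 * D.fn d t ^ 2) ?_ ?_ ?_ ?_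
      · intro n
        exact ((D.aestronglyMeasurable_fn (x n)).sub hgm).pow 2
      · exact (D.memLp_fn d).integrable_sq.const_mul 4
      · intro n
        filter_upwards [hd n, hgd] with t h1 h2
        rw [Real.norm_eq_abs, abs_of_nonneg (sq_nonneg _), ← sq_abs (D.fn d t),
          ← sq_abs (D.fn (x n) t - g t)]
        have := abs_sub (D.fn (x n) t) (g t)
        nlinarith [abs_nonneg (D.fn (x n) t - g t)]
      · filter_upwards [h] with t ht
        have := (ht.sub_const (g t)).pow 2
        simpa using this
    have h1 := (Real.continuous_sqrt.tendsto _).comp h0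
    simp only [integral_zero, Real.sqrt_zero] at h1
    refine h1.congr fun n => ?_
    rw [Function.comp_apply, ← Real.sqrt_sq (norm_nonneg (D.toLp (x n) - hg.toLp g)),
      ← real_inner_self_eq_norm_sq, L2.inner_def]
    congr 1
    refine integral_congr_ae ?_
    filter_upwards [Lp.coeFn_sub (D.toLp (x n)) (hg.toLp g), hg.coeFn_toLp] with t h1 h2
    simp only [h1, Pi.sub_apply, h2, fn_eq]
    simp [sq]
  obtain ⟨y, hy, hy'⟩ := D.exists_limit x C hx hlim
  refine ⟨y, ?_, hy'⟩
  rw [fn_eq, hy]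
  exact hg.coeFn_toLp

/-- Lattice operations are bounded in the Hilbert norm but not visibly continuous. An `L²` estimate
by null sequences still identifies the weak limit, and closed convex conditions pass to it. -/
theorem exists_limit_of_abs_le (x : ℕ → D.Dom) (C : ℝ) (hx : ∀ n, ‖x n‖ ≤ C) {g : K → ℝ}
    (hg : AEStronglyMeasurable g μ) (w w' : ℕ → D.Dom) (hw : Tendsto w atTop (𝓝 0))
    (hw' : Tendsto w' atTop (𝓝 0))
    (h : ∀ n, ∀ᵐ t ∂μ, |D.fn (x n) t - g t| ≤ |D.fn (w n) t| + |D.fn (w' n) t|) :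
    ∃ y : D.Dom, D.fn y =ᵐ[μ] g ∧
      ∀ S : Set D.Dom, IsClosed S → Convex ℝ S → (∀ᶠ n in atTop, x n ∈ S) → y ∈ S := by
  have hgL : MemLp g 2 μ := by
    have h1 : MemLp (fun t => D.fn (x 0) t - g t) 2 μ := by
      refine ((D.memLp_fn (w 0)).norm.add (D.memLp_fn (w' 0)).norm).mono
        ((D.aestronglyMeasurable_fn _).sub hg) ?_
      filter_upwards [h 0] with t ht
      simp only [Real.norm_eq_abs, Pi.add_apply]
      exact ht.trans (le_abs_self _)
    have h2 := (D.memLp_fn (x 0)).sub h1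
    refine h2.ae_eq (Eventually.of_forall fun t => ?_)
    simp
  have hlim : Tendsto (fun n => D.toLp (x n)) atTop (𝓝 (hgL.toLp g)) := by
    rw [tendsto_iff_norm_sub_tendsto_zero]
    have h0 : Tendsto (fun n => ‖w n‖ + ‖w' n‖) atTop (𝓝 0) := by
      simpa using hw.norm.add hw'.norm
    refine squeeze_zero (fun n => norm_nonneg _) (fun n => ?_) h0
    have h1 : ‖D.toLp (x n) - hgL.toLp g‖ ≤ ‖|D.toLp (w n)| + |D.toLp (w' n)|‖ := by
      refine Lp.norm_le_norm_of_ae_le ?_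
      filter_upwards [h n, Lp.coeFn_sub (D.toLp (x n)) (hgL.toLp g), hgL.coeFn_toLp,
        Lp.coeFn_add |D.toLp (w n)| |D.toLp (w' n)|, Lp.coeFn_abs (D.toLp (w n)),
        Lp.coeFn_abs (D.toLp (w' n))] with t h1 h2 h3 h4 h5 h6
      rw [h2, h4, Pi.sub_apply, Pi.add_apply, h3, h5, h6]
      exact h1.trans (le_abs_self _)
    refine h1.trans ((norm_add_le _ _).trans ?_)
    rw [norm_abs_eq_norm, norm_abs_eq_norm]
    exact add_le_add (D.norm_toLp_le _) (D.norm_toLp_le _)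
  obtain ⟨y, hy, hy'⟩ := D.exists_limit x C hx hlim
  refine ⟨y, ?_, hy'⟩
  rw [fn_eq, hy]
  exact hgL.coeFn_toLp

theorem exists_trunc {c : ℝ} (hc : 0 < c) (u : D.Dom) :
    ∃ v : D.Dom, D.fn v =ᵐ[μ] (fun x => min (max 0 (D.fn u x)) c) ∧ D.E v v ≤ D.E u u := by
  obtain ⟨g, hg, hg'⟩ : ∃ g : D.Dom,
      (D.fn g =ᵐ[μ] fun x => min (max 0 (D.fn (c⁻¹ • u) x)) 1) ∧
        D.E g g ≤ D.E (c⁻¹ • u) (c⁻¹ • u) := D.markov (c⁻¹ • u : D.Dom)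
  refine ⟨c • g, ?_, ?_⟩
  · filter_upwards [hg, D.fn_smul c g, D.fn_smul c⁻¹ u] with x h1 h2 h3
    rw [h2, h1, h3, mul_min_of_nonneg _ _ hc.le, mul_max_of_nonneg _ _ hc.le]
    field_simp
    simp
  · rw [E_smul_self] at *
    calc c ^ 2 * D.E g g ≤ c ^ 2 * (c⁻¹ ^ 2 * D.E u u) := by gcongr
      _ = D.E u u := by field_simp

open Classical in
/-- The truncation `(u ∨ 0) ∧ c`. -/
noncomputable def trunc (c : ℝ) (u : D.Dom) : D.Dom :=
  if h : 0 < c then (D.exists_trunc h u).choose else 0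

theorem fn_trunc {c : ℝ} (hc : 0 < c) (u : D.Dom) :
    D.fn (D.trunc c u) =ᵐ[μ] fun x => min (max 0 (D.fn u x)) c := by
  rw [trunc, dif_pos hc]
  exact (D.exists_trunc hc u).choose_spec.1

theorem E_trunc_le {c : ℝ} (hc : 0 < c) (u : D.Dom) :
    D.E (D.trunc c u) (D.trunc c u) ≤ D.E u u := by
  rw [trunc, dif_pos hc]
  exact (D.exists_trunc hc u).choose_spec.2

theorem norm_trunc_le {c : ℝ} (hc : 0 < c) (u : D.Dom) : ‖D.trunc c u‖ ≤ ‖u‖ := by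
  refine D.norm_le_of_le (D.E_trunc_le hc u) (D.norm_toLp_le_of_ae ?_)
  filter_upwards [D.fn_trunc hc u] with x hx
  rw [hx, abs_of_nonneg (le_min (le_max_left _ _) hc.le)]
  exact (min_le_left _ _).trans (max_le (abs_nonneg _) (le_abs_self _))

/-- The Markov property bounds only truncations at finite levels; these increase to the positive
part with energies bounded by that of `u`. The levels are `n + 1` because a level must be positive.
-/
theorem exists_pos (u : D.Dom) :
    ∃ v : D.Dom, D.fn v =ᵐ[μ] (fun x => max 0 (D.fn u x)) ∧ D.E v v ≤ D.E u u := by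
  have hn : ∀ n : ℕ, (0 : ℝ) < n + 1 := fun n => by positivity
  have hf : ∀ᵐ t ∂μ, ∀ n : ℕ, D.fn (D.trunc (n + 1) u) t = min (max 0 (D.fn u t)) (n + 1) :=
    ae_all_iff.2 fun n => D.fn_trunc (hn n) u
  obtain ⟨y, hy, hy'⟩ := D.exists_limit_of_dominated (fun n : ℕ => D.trunc (n + 1) u) ‖u‖
    (fun n => D.norm_trunc_le (hn n) u) (g := fun x => max 0 (D.fn u x)) u
    (by
      intro n
      filter_upwards [hf] with t ht
      rw [ht, abs_of_nonneg (le_min (le_max_left _ _) (hn n).le)]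
      exact (min_le_left _ _).trans (max_le (abs_nonneg _) (le_abs_self _)))
    (by
      filter_upwards [hf] with t ht
      refine tendsto_const_nhds.congr' ?_
      obtain ⟨N, hN⟩ := exists_nat_ge (max 0 (D.fn u t))
      filter_upwards [eventually_ge_atTop N] with n hnN
      rw [ht, min_eq_left]
      have : (N : ℝ) ≤ n := by exact_mod_cast hnN
      linarith)
  exact ⟨y, hy, hy' _ (D.isClosed_E_le _) (D.convex_E_le _)
    (Eventually.of_forall fun n => D.E_trunc_le (hn n) u)⟩

/-- The positive part. -/
noncomputable def pos (u : D.Dom) : D.Dom := (D.exists_pos u).choose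

theorem fn_pos (u : D.Dom) : D.fn (D.pos u) =ᵐ[μ] fun x => max 0 (D.fn u x) :=
  (D.exists_pos u).choose_spec.1

theorem E_pos_le (u : D.Dom) : D.E (D.pos u) (D.pos u) ≤ D.E u u :=
  (D.exists_pos u).choose_spec.2

theorem norm_pos_le (u : D.Dom) : ‖D.pos u‖ ≤ ‖u‖ := by
  refine D.norm_le_of_le (D.E_pos_le u) (D.norm_toLp_le_of_ae ?_)
  filter_upwards [D.fn_pos u] with x hx
  rw [hx, abs_of_nonneg (le_max_left _ _)]
  exact max_le (abs_nonneg _) (le_abs_self _)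

theorem pos_sub_pos_neg (u : D.Dom) : D.pos u - D.pos (-u) = u := by
  refine ext_fn ?_
  filter_upwards [D.fn_sub (D.pos u) (D.pos (-u)), D.fn_pos u, D.fn_pos (-u), D.fn_neg u]
    with x h1 h2 h3 h4
  rw [h1, h2, h3, h4]
  rcases le_total 0 (D.fn u x) with h | h
  · rw [max_eq_right h, max_eq_left (by linarith), sub_zero]
  · rw [max_eq_left h, max_eq_right (by linarith)]
    ring

/-- The minimum of two elements of the domain. -/
noncomputable def inf (u v : D.Dom) : D.Dom := u - D.pos (u - v)

theorem fn_inf (u v : D.Dom) : D.fn (D.inf u v) =ᵐ[μ] fun x => min (D.fn u x) (D.fn v x) := by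
  filter_upwards [D.fn_sub u (D.pos (u - v)), D.fn_pos (u - v), D.fn_sub u v] with x h1 h2 h3
  rw [inf, h1, h2, h3]
  rcases le_total (D.fn u x) (D.fn v x) with h | h
  · rw [max_eq_left (by linarith), min_eq_left h, sub_zero]
  · rw [max_eq_right (by linarith), min_eq_right h]
    ring

theorem norm_inf_le (u v : D.Dom) : ‖D.inf u v‖ ≤ 2 * ‖u‖ + ‖v‖ := by
  have h1 := norm_sub_le u (D.pos (u - v))
  have h2 := D.norm_pos_le (u - v)
  have h3 := norm_sub_le u v
  rw [inf]
  linarith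

end Lattice

end DirichletForm

theorem abs_max_zero_sub_le (a b : ℝ) : |max 0 a - max 0 b| ≤ |a - b| := by
  simpa [max_comm] using abs_max_sub_max_le_abs a b 0

/-- Error estimate for `a ∧ b` (positive parts) as an approximation of `v`, when `a` approximates
some `u ≥ v` and `b` approximates `v`. -/
theorem abs_min_max_zero_sub_le {a b u v : ℝ} (hv : 0 ≤ v) (huv : v ≤ u) :
    |min (max 0 a) (max 0 b) - v| ≤ |a - u| + |b - v| := by
  have h1 := neg_abs_le (a - u)
  have h3 := neg_abs_le (b - v)
  have h4 := le_abs_self (b - v)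
  have h5 := abs_nonneg (a - u)
  have h6 := abs_nonneg (b - v)
  rw [abs_le]
  constructor
  · rcases min_cases (max 0 a) (max 0 b) with h | h <;> rw [h.1]
    · linarith [le_max_right 0 a]
    · linarith [le_max_right 0 b]
  · have : max 0 b ≤ v + |b - v| := max_le (by linarith) (by linarith)
    linarith [min_le_right (max 0 a) (max 0 b)]

theorem exists_norm_le_of_tendsto {H : Type*} [SeminormedAddCommGroup H] {x : ℕ → H} {y : H}
    (h : Tendsto x atTop (𝓝 y)) : ∃ C, ∀ n, ‖x n‖ ≤ C := by
  obtain ⟨C, hC⟩ := h.norm.bddAbove_range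
  exact ⟨C, fun n => hC ⟨n, rfl⟩⟩

/-! ### Functions vanishing off an open set, cutoffs, and locality -/

namespace DirichletForm

section Core

variable {K : Type*} [TopologicalSpace K] [MeasurableSpace K] {μ : Measure K}
  (D : DirichletForm μ)

/-- The elements of the domain with a continuous representative that vanishes off a compact subset
of `U`. -/
def core (U : Set K) : Submodule ℝ D.Dom where
  carrier := {u | ∃ (φ : K → ℝ) (T : Set K), Continuous φ ∧ IsCompact T ∧ T ⊆ U ∧
    (∀ x ∉ T, φ x = 0) ∧ D.fn u =ᵐ[μ] φ}
  zero_mem' := ⟨fun _ => 0, ∅, continuous_const, isCompact_empty, empty_subset _,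
    fun _ _ => rfl, D.fn_zero⟩
  add_mem' := by
    rintro u v ⟨φ, T, h1, h2, h3, h4, h5⟩ ⟨φ', T', h1', h2', h3', h4', h5'⟩
    refine ⟨fun x => φ x + φ' x, T ∪ T', h1.add h1', h2.union h2', union_subset h3 h3', ?_, ?_⟩
    · intro x hx
      rw [mem_union, not_or] at hx
      beta_reduce
      rw [h4 x hx.1, h4' x hx.2, add_zero]
    · filter_upwards [D.fn_add u v, h5, h5'] with x a b c
      rw [a, b, c]
  smul_mem' := by
    rintro c u ⟨φ, T, h1, h2, h3, h4, h5⟩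
    refine ⟨fun x => c * φ x, T, h1.const_mul c, h2, h3, fun x hx => by simp [h4 x hx], ?_⟩
    filter_upwards [D.fn_smul c u, h5] with x a b
    rw [a, b]

variable {D}

theorem core_mono {U V : Set K} (h : U ⊆ V) : D.core U ≤ D.core V := by
  rintro u ⟨φ, T, h1, h2, h3, h4⟩
  exact ⟨φ, T, h1, h2, h3.trans h, h4⟩

theorem pos_mem_core {U : Set K} {u : D.Dom} (hu : u ∈ D.core U) : D.pos u ∈ D.core U := by
  obtain ⟨φ, T, h1, h2, h3, h4, h5⟩ := hu
  refine ⟨fun x => max 0 (φ x), T, continuous_const.max h1, h2, h3, fun x hx => ?_, ?_⟩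
  · beta_reduce
    rw [h4 x hx, max_self]
  · filter_upwards [D.fn_pos u, h5] with x a b
    rw [a, b]

theorem inf_pos_mem_core {U V : Set K} {u v : D.Dom} (hu : u ∈ D.core U) (hv : v ∈ D.core V) :
    D.inf (D.pos u) (D.pos v) ∈ D.core U := by
  obtain ⟨φ, T, h1, h2, h3, h4, h5⟩ := hu
  obtain ⟨φ', T', h1', h2', h3', h4', h5'⟩ := hv
  refine ⟨fun x => min (max 0 (φ x)) (max 0 (φ' x)), T,
    (continuous_const.max h1).min (continuous_const.max h1'), h2, h3, fun x hx => ?_, ?_⟩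
  · beta_reduce
    rw [h4 x hx, max_self, min_eq_left (le_max_left _ _)]
  · filter_upwards [D.fn_inf (D.pos u) (D.pos v), D.fn_pos u, D.fn_pos v, h5, h5'] with x a b c d e
    rw [a, b, c, d, e]

variable (D)

/-- The closure in the domain of the elements of the core supported in `U`. -/
noncomputable def F0 (U : Set K) : Submodule ℝ D.Dom := (D.core U).topologicalClosure

variable {D}

theorem isClosed_F0 (U : Set K) : IsClosed (D.F0 U : Set D.Dom) :=
  Submodule.isClosed_topologicalClosure _

theorem core_le_F0 (U : Set K) : D.core U ≤ D.F0 U := Submodule.le_topologicalClosure _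

theorem F0_mono {U V : Set K} (h : U ⊆ V) : D.F0 U ≤ D.F0 V :=
  Submodule.topologicalClosure_mono (core_mono h)

theorem exists_seq_of_mem_F0 {U : Set K} {u : D.Dom} (hu : u ∈ D.F0 U) :
    ∃ w : ℕ → D.Dom, (∀ n, w n ∈ D.core U) ∧ Tendsto w atTop (𝓝 u) :=
  mem_closure_iff_seq_limit.1 hu

theorem mem_F0_univ (hreg : D.IsRegular) (u : D.Dom) : u ∈ D.F0 univ := by
  refine Metric.mem_closure_iff.2 fun ε hε => ?_
  obtain ⟨g, ⟨φ, hφ⟩, hg⟩ : ∃ g : D.Dom, (∃ φ : C_c(K, ℝ), D.fn g =ᵐ[μ] φ) ∧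
      √(D.normSq (u - g : D.Dom)) < ε := hreg.dense_domain u ε hε
  refine ⟨g, ⟨φ, tsupport φ, φ.continuous, φ.hasCompactSupport, subset_univ _,
    fun x hx => image_eq_zero_of_notMem_tsupport hx, hφ⟩, ?_⟩
  rwa [normSq_eq, Real.sqrt_sq (norm_nonneg _), ← dist_eq_norm] at hg

theorem E_eq_zero_of_core (hreg : D.IsRegular) {u : D.Dom} (h : ∀ φ ∈ D.core univ, D.E u φ = 0)
    (w : D.Dom) : D.E u w = 0 := by
  have h1 : (D.F0 univ : Set D.Dom) ⊆ {w | D.E u w = 0} :=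
    closure_minimal h (isClosed_eq (D.continuous_E_right u) continuous_const)
  exact h1 (mem_F0_univ hreg w)

theorem fn_eq_zero_of_mem_F0 {U : Set K} {u : D.Dom} (hu : u ∈ D.F0 U) :
    ∀ᵐ x ∂μ, x ∉ U → D.fn u x = 0 := by
  classical
  have h : (D.F0 U : Set D.Dom)
      ⊆ {u : D.Dom | ∀ᵐ x ∂μ, D.fn u x ∈ (if x ∈ U then univ else {0} : Set ℝ)} := by
    refine closure_minimal ?_ (D.isClosed_ae_mem _ fun x => ?_)
    · rintro v ⟨φ, T, h1, h2, h3, h4, h5⟩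
      simp only [mem_ofPred_eq]
      filter_upwards [h5] with x hx
      split_ifs with hxU
      · trivial
      · rw [hx]
        exact h4 x fun hxT => hxU (h3 hxT)
    · split_ifs
      · exact isClosed_univ
      · exact isClosed_singleton
  have h1 := h hu
  simp only [mem_ofPred_eq] at h1
  filter_upwards [h1] with x hx hxU
  simpa [hxU] using hx

/-- Positive parts of core approximants are bounded in norm and converge in `L²` to the positive
part of `u`. -/
theorem pos_mem_F0 {U : Set K} {u : D.Dom} (hu : u ∈ D.F0 U) : D.pos u ∈ D.F0 U := by
  obtain ⟨w, hw, hwu⟩ := exists_seq_of_mem_F0 hu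
  obtain ⟨C, hC⟩ := exists_norm_le_of_tendsto hwu
  obtain ⟨y, hy, hy'⟩ := D.exists_limit_of_abs_le (fun n => D.pos (w n)) C
    (fun n => (D.norm_pos_le _).trans (hC n)) (D.aestronglyMeasurable_fn (D.pos u))
    (fun n => w n - u) (fun _ => 0) (by simpa using hwu.sub_const u) tendsto_const_nhds (by
      intro n
      filter_upwards [D.fn_pos (w n), D.fn_pos u, D.fn_sub (w n) u] with t h1 h2 h3
      rw [h1, h2, h3]
      exact (abs_max_zero_sub_le _ _).trans (le_add_of_nonneg_right (abs_nonneg _)))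
  rw [← ext_fn hy]
  exact hy' _ (isClosed_F0 U) (D.F0 U).convex
    (Eventually.of_forall fun n => core_le_F0 U (pos_mem_core (hw n)))

/-- `F0 U` is solid: if core elements `w n` supported in `U` approximate `u` and compactly supported
`w' n` approximate `v`, then the minima of their positive parts are supported in `U` and approximate
`v`. -/
theorem mem_F0_of_nonneg_of_le (hreg : D.IsRegular) {U : Set K} {u v : D.Dom} (hu : u ∈ D.F0 U)
    (h : ∀ᵐ x ∂μ, 0 ≤ D.fn v x ∧ D.fn v x ≤ D.fn u x) : v ∈ D.F0 U := by
  obtain ⟨w, hw, hwu⟩ := exists_seq_of_mem_F0 hu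
  obtain ⟨w', hw', hwv⟩ := exists_seq_of_mem_F0 (mem_F0_univ hreg v)
  obtain ⟨C, hC⟩ := exists_norm_le_of_tendsto hwu
  obtain ⟨C', hC'⟩ := exists_norm_le_of_tendsto hwv
  obtain ⟨y, hy, hy'⟩ := D.exists_limit_of_abs_le (fun n => D.inf (D.pos (w n)) (D.pos (w' n)))
    (2 * C + C') (fun n => (D.norm_inf_le _ _).trans
      (by linarith [(D.norm_pos_le (w n)).trans (hC n), (D.norm_pos_le (w' n)).trans (hC' n)]))
    (D.aestronglyMeasurable_fn v)
    (fun n => w n - u) (fun n => w' n - v) (by simpa using hwu.sub_const u)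
    (by simpa using hwv.sub_const v) (by
      intro n
      filter_upwards [D.fn_inf (D.pos (w n)) (D.pos (w' n)), D.fn_pos (w n), D.fn_pos (w' n),
        D.fn_sub (w n) u, D.fn_sub (w' n) v, h] with t h1 h2 h3 h4 h5 h6
      rw [h1, h2, h3, h4, h5]
      exact abs_min_max_zero_sub_le h6.1 h6.2)
  rw [← ext_fn hy]
  exact hy' _ (isClosed_F0 U) (D.F0 U).convex
    (Eventually.of_forall fun n => core_le_F0 U (inf_pos_mem_core (hw n) (hw' n)))

theorem mem_F0_of_abs_le (hreg : D.IsRegular) {U : Set K} {u v : D.Dom} (hu : u ∈ D.F0 U)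
    (h : ∀ᵐ x ∂μ, |D.fn v x| ≤ |D.fn u x|) : v ∈ D.F0 U := by
  have ha : D.pos u + D.pos (-u) ∈ D.F0 U :=
    add_mem (pos_mem_F0 hu) (pos_mem_F0 (neg_mem hu))
  have hfa : D.fn (D.pos u + D.pos (-u)) =ᵐ[μ] fun x => |D.fn u x| := by
    filter_upwards [D.fn_add (D.pos u) (D.pos (-u)), D.fn_pos u, D.fn_pos (-u), D.fn_neg u]
      with x h1 h2 h3 h4
    rw [h1, h2, h3, h4]
    rcases le_total 0 (D.fn u x) with h | h
    · rw [max_eq_right h, max_eq_left (by linarith), abs_of_nonneg h, add_zero]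
    · rw [max_eq_left h, max_eq_right (by linarith), abs_of_nonpos h, zero_add]
  rw [← D.pos_sub_pos_neg v]
  refine sub_mem (mem_F0_of_nonneg_of_le hreg ha ?_) (mem_F0_of_nonneg_of_le hreg ha ?_)
  · filter_upwards [hfa, D.fn_pos v, h] with x h1 h2 h3
    rw [h1, h2]
    exact ⟨le_max_left _ _, max_le (abs_nonneg _) ((le_abs_self _).trans h3)⟩
  · filter_upwards [hfa, D.fn_pos (-v), D.fn_neg v, h] with x h1 h2 h4 h3
    rw [h1, h2, h4]
    exact ⟨le_max_left _ _, max_le (abs_nonneg _) ((neg_le_abs _).trans h3)⟩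

/-- Cutoff functions. -/
theorem exists_cutoff [LocallyCompactSpace K] [T2Space K] (hreg : D.IsRegular) {C U : Set K}
    (hC : IsCompact C) (hU : IsOpen U) (hCU : C ⊆ U) :
    ∃ χ ∈ D.core U, ∃ O : Set K, IsOpen O ∧ C ⊆ O ∧ (∀ᵐ x ∂μ, 0 ≤ D.fn χ x) ∧
      ∀ᵐ x ∂μ, x ∈ O → D.fn χ x = 1 := by
  obtain ⟨L, hL, hCL, hLU⟩ := exists_compact_between hC hU hCU
  obtain ⟨L', hL', hLL', hLU'⟩ := exists_compact_between hL hU hLU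
  obtain ⟨f, hf1, hf0, hfc, hf01⟩ := exists_continuous_one_zero_of_isCompact hL
    (isOpen_interior (s := L')).isClosed_compl (disjoint_compl_right_iff_subset.2 hLL')
  -- With `ψ` within `1` of `3 f`, one has `ψ > 2` where `f = 1` and `ψ < 1` where `f = 0`. Hence
  -- `(ψ⁺ - ψ⁺ ∧ 1) ∧ 1` is exactly `1`, respectively `0`, there.
  let φ : C_c(K, ℝ) := ⟨(3 : ℝ) • f, by
    refine HasCompactSupport.intro hL' fun x hx => ?_
    have := hf0 (show x ∈ (interior L')ᶜ from fun h => hx (interior_subset h))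
    simp [this]⟩
  obtain ⟨ψ, ⟨g, hg⟩, hψ⟩ : ∃ ψ : C_c(K, ℝ), (∃ g : D.Dom, D.fn g =ᵐ[μ] ψ) ∧
      ∀ x, |φ x - ψ x| < 1 := hreg.dense_cc φ 1 one_pos
  have hφ : ∀ x, φ x = 3 * f x := fun x => rfl
  have h0 : (0 : ℝ) < 1 := one_pos
  have hfn : D.fn (D.trunc 1 (D.pos g - D.trunc 1 g)) =ᵐ[μ]
      fun x => min (max 0 (max 0 (ψ x) - min (max 0 (ψ x)) 1)) 1 := by
    filter_upwards [D.fn_trunc h0 (D.pos g - D.trunc 1 g), D.fn_sub (D.pos g) (D.trunc 1 g),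
      D.fn_pos g, D.fn_trunc h0 g, hg] with x h1 h2 h3 h4 h5
    rw [h1, h2, h3, h4, h5]
  refine ⟨D.trunc 1 (D.pos g - D.trunc 1 g), ⟨_, L', ?_, hL', hLU', ?_, hfn⟩,
    interior L, isOpen_interior, hCL, ?_, ?_⟩
  · have := ψ.continuous
    fun_prop
  · intro x hx
    have h1 := hf0 (show x ∈ (interior L')ᶜ from fun h => hx (interior_subset h))
    have h2 := hψ x
    rw [hφ, h1] at h2
    simp only [Pi.zero_apply, mul_zero, zero_sub, abs_neg] at h2
    have h3 := (le_abs_self _).trans h2.le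
    rw [min_eq_left (max_le zero_le_one h3), sub_self, max_self, min_eq_left zero_le_one]
  · filter_upwards [hfn] with x hx
    rw [hx]
    exact le_min (le_max_left _ _) zero_le_one
  · filter_upwards [hfn] with x hx hxL
    have h1 := hf1 (interior_subset hxL)
    have h2 := hψ x
    rw [hφ, h1, Pi.one_apply, mul_one] at h2
    have h3 := (le_abs_self _).trans h2.le
    rw [hx, max_eq_right (by linarith : (0:ℝ) ≤ ψ x), min_eq_right (by linarith : (1:ℝ) ≤ ψ x),
      max_eq_right (by linarith), min_eq_right (by linarith)]

theorem E_eq_zero_of_const_near [BorelSpace K] (hloc : D.IsStronglyLocal) {u v : D.Dom}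
    {T O : Set K} {c : ℝ} (hT : IsClosed T) (hu : ∀ᵐ x ∂μ, x ∉ T → D.fn u x = 0) (hO : IsOpen O)
    (hTO : T ⊆ O) (hv : ∀ᵐ x ∂μ, x ∈ O → D.fn v x = c) : D.E u v = 0 := by
  refine hloc u v ⟨O, c, hO, fun x hx => hTO ?_, hv⟩
  by_contra hxT
  have h1 : 0 < ∫⁻ y in Tᶜ, ‖D.fn u y‖ₑ ∂μ := hx Tᶜ (hT.isOpen_compl.mem_nhds hxT)
  refine h1.ne' ?_
  rw [lintegral_eq_zero_iff' (D.memLp_fn u).1.enorm.restrict]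
  filter_upwards [(ae_restrict_iff' hT.isOpen_compl.measurableSet).2 hu] with y hy
  simpa using hy

/-- For `u` in the core, its compact support lies in `U`, where `v` is constantly `0`; the general
case follows by continuity of the form. -/
theorem E_eq_zero_of_mem_F0 [BorelSpace K] [T2Space K] (hloc : D.IsStronglyLocal) {U : Set K}
    (hU : IsOpen U) {u v : D.Dom} (hu : u ∈ D.F0 U) (hv : ∀ᵐ x ∂μ, x ∈ U → D.fn v x = 0) :
    D.E u v = 0 := by
  have h : (D.F0 U : Set D.Dom) ⊆ {u : D.Dom | D.E u v = 0} := by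
    refine closure_minimal ?_ (isClosed_eq (D.continuous_E_left v) continuous_const)
    rintro w ⟨φ, T, h1, h2, h3, h4, h5⟩
    refine E_eq_zero_of_const_near hloc h2.isClosed ?_ hU h3 hv
    filter_upwards [h5] with x hx hxT
    rw [hx, h4 x hxT]
  exact h hu

end Core

end DirichletForm

/-! ### Spectral synthesis -/

namespace DirichletForm

section Synthesis

variable {K : Type*} [TopologicalSpace K] [MeasurableSpace K] {μ : Measure K}
  {D : DirichletForm μ}

theorem exists_of_cap_lt {A : Set K} {ε : ℝ} (hε : 0 < ε) (h : D.cap A < ENNReal.ofReal (ε ^ 2)) :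
    ∃ (e : D.Dom) (O : Set K), IsOpen O ∧ A ⊆ O ∧ (∀ᵐ x ∂μ, x ∈ O → 1 ≤ D.fn e x) ∧
      (∀ᵐ x ∂μ, 0 ≤ D.fn e x) ∧ ‖e‖ ≤ ε := by
  rw [cap, iInf_lt_iff] at h
  obtain ⟨e, he⟩ := h
  rw [iInf_lt_iff] at he
  obtain ⟨⟨O, hO, hAO, heO⟩, he⟩ := he
  replace he : ENNReal.ofReal (D.normSq (show D.Dom from e)) < ENNReal.ofReal (ε ^ 2) := he
  replace heO : ∀ᵐ x ∂μ, x ∈ O → 1 ≤ D.fn e x := heO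
  generalize (show D.Dom from e) = e at he heO
  rw [ENNReal.ofReal_lt_ofReal_iff (by positivity), normSq_eq] at he
  refine ⟨D.pos e, O, hO, hAO, ?_, ?_, ?_⟩
  · filter_upwards [heO, D.fn_pos e] with x h1 h2 hx
    rw [h2]
    exact (h1 hx).trans (le_max_right _ _)
  · filter_upwards [D.fn_pos e] with x h2
    rw [h2]
    exact le_max_left _ _
  · exact (D.norm_pos_le e).trans (lt_of_pow_lt_pow_left₀ 2 hε.le he).le

/-- One small function absorbs three exceptional sets, with a third of `ε` for each: the
discontinuities of `f'`, those of `g'`, and the set `N` where they differ. -/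
theorem exists_exceptional {f' g' : K → ℝ} (hf : D.IsQuasiContinuous f')
    (hg : D.IsQuasiContinuous g') {N : Set K} (hN : D.cap N = 0) {ε : ℝ} (hε : 0 < ε) :
    ∃ (e : D.Dom) (O : Set K), IsOpen O ∧ N ⊆ O ∧ (∀ᵐ x ∂μ, x ∈ O → 1 ≤ D.fn e x) ∧
      (∀ᵐ x ∂μ, 0 ≤ D.fn e x) ∧ ‖e‖ ≤ ε ∧ ContinuousOn (fun x => f' x - g' x) Oᶜ := by
  have h3 : 0 < ε / 3 := by positivity
  have h4 : 0 < ENNReal.ofReal ((ε / 3) ^ 2) := ENNReal.ofReal_pos.2 (by positivity)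
  obtain ⟨G, hG, hGc, hGf⟩ := hf _ h4
  obtain ⟨G', hG', hGc', hGg⟩ := hg _ h4
  obtain ⟨e₁, O₁, a₁, b₁, c₁, d₁, n₁⟩ := exists_of_cap_lt h3 hGc
  obtain ⟨e₂, O₂, a₂, b₂, c₂, d₂, n₂⟩ := exists_of_cap_lt h3 hGc'
  obtain ⟨e₃, O₃, a₃, b₃, c₃, d₃, n₃⟩ := exists_of_cap_lt h3 (hN ▸ h4)
  have hfn : D.fn (e₁ + e₂ + e₃) =ᵐ[μ] fun x => D.fn e₁ x + D.fn e₂ x + D.fn e₃ x := by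
    filter_upwards [D.fn_add (e₁ + e₂) e₃, D.fn_add e₁ e₂] with x h1 h2
    rw [h1, h2]
  refine ⟨e₁ + e₂ + e₃, O₁ ∪ O₂ ∪ O₃, (a₁.union a₂).union a₃, fun x hx => Or.inr (b₃ hx),
    ?_, ?_, ?_, ?_⟩
  · filter_upwards [hfn, c₁, c₂, c₃, d₁, d₂, d₃] with x h p q r p' q' r' hx
    rw [h]
    rcases hx with (hx | hx) | hx
    · linarith [p hx]
    · linarith [q hx]
    · linarith [r hx]
  · filter_upwards [hfn, d₁, d₂, d₃] with x h p' q' r'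
    rw [h]
    linarith
  · have := norm_add₃_le (a := e₁) (b := e₂) (c := e₃)
    linarith
  · refine (hGf.mono ?_).sub (hGg.mono ?_)
    · exact compl_subset_compl.2 fun x hx => Or.inl (Or.inl (b₁ hx))
    · exact compl_subset_compl.2 fun x hx => Or.inl (Or.inr (b₂ hx))

variable [LocallyCompactSpace K] [T2Space K]

/-- The nonnegative part of the spectral synthesis, under boundedness assumptions. -/
theorem mem_F0_of_le_of_eqQE (hreg : D.IsRegular) {U : Set K} (hU : IsOpen U) {f' g' : K → ℝ}
    (hf : D.IsQuasiContinuous f') (hg : D.IsQuasiContinuous g')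
    (hN : D.cap {x ∈ Uᶜ | f' x ≠ g' x} = 0) {x : D.Dom} {T : Set K} (hT : IsCompact T) {M : ℝ}
    (hM : 0 < M) (h0 : ∀ᵐ t ∂μ, 0 ≤ D.fn x t) (hxM : ∀ᵐ t ∂μ, D.fn x t ≤ M)
    (hxT : ∀ᵐ t ∂μ, t ∉ T → D.fn x t = 0)
    (hx : ∀ᵐ t ∂μ, D.fn x t ≤ max 0 (f' t - g' t)) : x ∈ D.F0 U := by
  have hpos : ∀ n : ℕ, (0 : ℝ) < 1 / (n + 1) := fun n => Nat.one_div_pos_of_nat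
  -- With `e n` small and at least `1` on `O n`, the function `(x - x ∧ ε - M e n)⁺` lives on the
  -- part of `T` outside `O n` where `f' - g' ≥ ε`. That set is compact and contained in `U`, so a
  -- cutoff dominates the function. Then `n → ∞` and finally `ε → 0`.
  have hsub : ∀ ε : ℝ, 0 < ε → x - D.trunc ε x ∈ D.F0 U := by
    intro ε hε
    set y := x - D.trunc ε x with hy
    have hfy : D.fn y =ᵐ[μ] fun t => D.fn x t - min (D.fn x t) ε := by
      filter_upwards [D.fn_sub x (D.trunc ε x), D.fn_trunc hε x, h0] with t h1 h2 h3
      rw [h1, h2, max_eq_right h3]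
    choose e O hO hNO he1 he0 hen hcont using
      fun n : ℕ => exists_exceptional hf hg hN (hpos n)
    have hfz : ∀ n, D.fn (D.pos (y - M • e n)) =ᵐ[μ]
        fun t => max 0 (D.fn y t - M * D.fn (e n) t) := by
      intro n
      filter_upwards [D.fn_pos (y - M • e n), D.fn_sub y (M • e n), D.fn_smul M (e n)]
        with t h1 h2 h3
      rw [h1, h2, h3]
    have hz : ∀ n, D.pos (y - M • e n) ∈ D.F0 U := by
      intro n
      have hcl : IsClosed ((O n)ᶜ ∩ (fun t => f' t - g' t) ⁻¹' Ici ε) :=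
        (hcont n).preimage_isClosed_of_isClosed (hO n).isClosed_compl isClosed_Ici
      have hCU : T ∩ ((O n)ᶜ ∩ (fun t => f' t - g' t) ⁻¹' Ici ε) ⊆ U := by
        rintro t ⟨-, htO, ht⟩
        by_contra htU
        refine htO (hNO n ⟨htU, fun h => ?_⟩)
        have h2 : ε ≤ f' t - g' t := ht
        rw [h, sub_self] at h2
        linarith
      obtain ⟨χ, hχ, O', -, hO', hχ0, hχ1⟩ := exists_cutoff hreg (hT.inter_right hcl) hU hCU
      refine mem_F0_of_nonneg_of_le hreg (core_le_F0 U ((D.core U).smul_mem M hχ)) ?_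
      filter_upwards [hfz n, hfy, D.fn_smul M χ, hχ0, hχ1, he1 n, he0 n, h0, hxM, hxT, hx]
        with t h1 h2 h3 h4 h5 h6 h7 h8 h9 h10 h11
      rw [h1, h2, h3]
      refine ⟨le_max_left _ _, max_le (by positivity) ?_⟩
      have hMe : 0 ≤ M * D.fn (e n) t := by positivity
      have hMχ : 0 ≤ M * D.fn χ t := by positivity
      have hmin : 0 ≤ min (D.fn x t) ε := le_min h8 hε.le
      by_cases htT : t ∈ T
      · by_cases htO : t ∈ O n
        · have := mul_le_mul_of_nonneg_left (h6 htO) hM.le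
          linarith
        · by_cases htε : ε ≤ f' t - g' t
          · rw [h5 (hO' ⟨htT, htO, htε⟩)]
            linarith
          · push Not at htε
            rw [min_eq_left (h11.trans (max_le hε.le htε.le))]
            linarith
      · rw [h10 htT] at *
        linarith
    have hen0 : Tendsto (fun n => M • e n) atTop (𝓝 0) := by
      have h1 : Tendsto e atTop (𝓝 0) :=
        squeeze_zero_norm hen tendsto_one_div_add_atTop_nhds_zero_nat
      simpa using h1.const_smul M
    obtain ⟨y', hy', hy''⟩ := D.exists_limit_of_abs_le (fun n => D.pos (y - M • e n)) (‖y‖ + M)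
      (fun n => by
        refine (D.norm_pos_le _).trans ((norm_sub_le _ _).trans ?_)
        rw [norm_smul, Real.norm_eq_abs, abs_of_pos hM]
        have h1 : (1 : ℝ) / (n + 1) ≤ 1 := by
          rw [div_le_one (by positivity)]
          linarith [(Nat.cast_nonneg n : (0 : ℝ) ≤ n)]
        have := mul_le_mul_of_nonneg_left ((hen n).trans h1) hM.le
        linarith)
      (D.aestronglyMeasurable_fn y) (fun n => M • e n) (fun _ => 0) hen0 tendsto_const_nhds (by
        intro n
        filter_upwards [hfz n, hfy, D.fn_smul M (e n)] with t h1 h2 h3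
        rw [h1, h3]
        have h4 : D.fn y t = max 0 (D.fn y t) := by
          rw [max_eq_right]
          rw [h2, sub_nonneg]
          exact min_le_left _ _
        refine le_trans ?_ (le_add_of_nonneg_right (abs_nonneg _))
        nth_rewrite 2 [h4]
        refine (abs_max_zero_sub_le _ _).trans (le_of_eq ?_)
        rw [sub_sub_cancel_left, abs_neg])
    rw [← ext_fn hy']
    exact hy'' _ (isClosed_F0 U) (D.F0 U).convex (Eventually.of_forall hz)
  obtain ⟨x', hx', hx''⟩ := D.exists_limit_of_dominated
    (fun n : ℕ => x - D.trunc (1 / (n + 1)) x) (‖x‖ + ‖x‖)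
    (fun n => (norm_sub_le _ _).trans (by gcongr; exact D.norm_trunc_le (hpos n) x))
    (g := D.fn x) x (by
      intro n
      filter_upwards [D.fn_sub x (D.trunc (1 / (n + 1)) x), D.fn_trunc (hpos n) x, h0]
        with t h1 h2 h3
      have h4 := min_le_left (D.fn x t) (1 / (n + 1))
      have h5 : 0 ≤ min (D.fn x t) (1 / (n + 1)) := le_min h3 (hpos n).le
      rw [h1, h2, max_eq_right h3, abs_of_nonneg h3, abs_of_nonneg (by linarith)]
      linarith) (by
      have h1 : ∀ᵐ t ∂μ, ∀ n : ℕ, D.fn (x - D.trunc (1 / (n + 1)) x) t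
          = D.fn x t - min (D.fn x t) (1 / (n + 1)) := by
        refine ae_all_iff.2 fun n => ?_
        filter_upwards [D.fn_sub x (D.trunc (1 / (n + 1)) x), D.fn_trunc (hpos n) x, h0]
          with t h1 h2 h3
        rw [h1, h2, max_eq_right h3]
      filter_upwards [h1, h0] with t ht ht0
      simp_rw [ht]
      have h2 : Tendsto (fun n : ℕ => min (D.fn x t) (1 / ((n : ℝ) + 1))) atTop (𝓝 0) :=
        squeeze_zero (fun n => le_min ht0 (hpos n).le) (fun n => min_le_right _ _)
          tendsto_one_div_add_atTop_nhds_zero_nat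
      simpa using h2.const_sub (D.fn x t))
  rw [← ext_fn hx']
  exact hx'' _ (isClosed_F0 U) (D.F0 U).convex (Eventually.of_forall fun n => hsub _ (hpos n))

/-- Taking minima with core approximants of the positive part reduces to bounded functions supported
in a compact set. -/
theorem pos_sub_mem_F0_of_eqQEOn (hreg : D.IsRegular) {U : Set K} (hU : IsOpen U) {f g : D.Dom}
    {f' g' : K → ℝ} (hf : D.IsQuasiContinuous f') (hg : D.IsQuasiContinuous g')
    (hff : D.fn f =ᵐ[μ] f') (hgg : D.fn g =ᵐ[μ] g')
    (hN : D.cap {x ∈ Uᶜ | f' x ≠ g' x} = 0) : D.pos (f - g) ∈ D.F0 U := by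
  obtain ⟨w, hw, hwu⟩ := exists_seq_of_mem_F0 (mem_F0_univ hreg (D.pos (f - g)))
  obtain ⟨C, hC⟩ := exists_norm_le_of_tendsto hwu
  set p := D.pos (f - g) with hp
  have hfp : D.fn p =ᵐ[μ] fun t => max 0 (f' t - g' t) := by
    filter_upwards [D.fn_pos (f - g), D.fn_sub f g, hff, hgg] with t h1 h2 h3 h4
    rw [h1, h2, h3, h4]
  have hfx : ∀ n, D.fn (D.inf (D.pos p) (D.pos (w n))) =ᵐ[μ]
      fun t => min (max 0 (D.fn p t)) (max 0 (D.fn (w n) t)) := by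
    intro n
    filter_upwards [D.fn_inf (D.pos p) (D.pos (w n)), D.fn_pos p, D.fn_pos (w n)] with t h1 h2 h3
    rw [h1, h2, h3]
  have hx : ∀ n, D.inf (D.pos p) (D.pos (w n)) ∈ D.F0 U := by
    intro n
    obtain ⟨φ, T, h1, h2, -, h4, h5⟩ := hw n
    obtain ⟨M, hM⟩ := h2.exists_bound_of_continuousOn h1.continuousOn
    refine mem_F0_of_le_of_eqQE hreg hU hf hg hN h2 (M := |M| + 1) (by positivity) ?_ ?_ ?_ ?_
    · filter_upwards [hfx n] with t ht
      rw [ht]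
      exact le_min (le_max_left _ _) (le_max_left _ _)
    · filter_upwards [hfx n, h5] with t ht ht5
      rw [ht, ht5]
      refine (min_le_right _ _).trans (max_le (by positivity) ?_)
      by_cases htT : t ∈ T
      · have := (le_abs_self _).trans (hM t htT)
        linarith [le_abs_self M]
      · rw [h4 t htT]
        positivity
    · filter_upwards [hfx n, h5] with t ht ht5 htT
      rw [ht, ht5, h4 t htT, max_self, min_eq_right (le_max_left _ _)]
    · filter_upwards [hfx n, hfp] with t ht htp
      rw [ht, ← htp]
      refine (min_le_left _ _).trans (max_le ?_ le_rfl)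
      rw [htp]
      exact le_max_left _ _
  obtain ⟨y, hy, hy'⟩ := D.exists_limit_of_abs_le (fun n => D.inf (D.pos p) (D.pos (w n)))
    (2 * ‖p‖ + C) (fun n => (D.norm_inf_le _ _).trans
      (by linarith [D.norm_pos_le p, (D.norm_pos_le (w n)).trans (hC n)]))
    (D.aestronglyMeasurable_fn p) (fun _ => 0) (fun n => w n - p) tendsto_const_nhds
    (by simpa using hwu.sub_const p) (by
      intro n
      filter_upwards [hfx n, D.fn_sub (w n) p, hfp] with t h1 h2 h3
      have h0 : 0 ≤ D.fn p t := by
        rw [h3]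
        exact le_max_left _ _
      rw [h1, h2]
      refine (abs_min_max_zero_sub_le h0 le_rfl).trans ?_
      rw [sub_self, abs_zero, zero_add]
      exact le_add_of_nonneg_left (abs_nonneg _))
  rw [← ext_fn hy]
  exact hy' _ (isClosed_F0 U) (D.F0 U).convex (Eventually.of_forall hx)

/-- Spectral synthesis: an element of the domain that vanishes quasi-everywhere off an open set `U`
is a limit of elements of the core supported in `U`. -/
theorem sub_mem_F0_of_eqQEOn (hreg : D.IsRegular) {U : Set K} (hU : IsOpen U) {f g : D.Dom}
    (h : D.EqQEOn f g Uᶜ) : f - g ∈ D.F0 U := by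
  obtain ⟨f', g', hf, hg, hff, hgg, hN⟩ := h
  have h1 := pos_sub_mem_F0_of_eqQEOn hreg hU hf hg hff hgg hN
  have h2 := pos_sub_mem_F0_of_eqQEOn hreg hU hg hf hgg hff (by simpa only [ne_comm] using hN)
  rw [← D.pos_sub_pos_neg (f - g), neg_sub]
  exact sub_mem h1 h2

/-- A competitor is `h + ψ` with `ψ ∈ F0 U` by spectral synthesis, and the cross term in its energy
vanishes. -/
theorem isHarmonicOn_of_E_eq_zero (hreg : D.IsRegular) {U : Set K} (hU : IsOpen U) {h : D.Dom}
    (hh : ∀ ψ ∈ D.F0 U, D.E h ψ = 0) : D.IsHarmonicOn h U := by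
  suffices H : ∀ f : D.Dom, D.EqQEOn f h Uᶜ → D.E h h ≤ D.E f f from H
  intro f hf
  have h1 := hh _ (sub_mem_F0_of_eqQEOn hreg hU hf)
  have h2 := D.E_add_self h (f - h)
  rw [h1, add_sub_cancel] at h2
  linarith [D.E_nonneg (f - h)]

end Synthesis

end DirichletForm

/-! ### Reflections and multiplication by indicators -/

namespace DirichletForm

section Reflection

variable {K : Type*} [MeasurableSpace K] {μ : Measure K} (D : DirichletForm μ)

/-- `s = (1_A - 1_{Aᶜ}) u`. -/
def Reflects (A : Set K) (u s : D.Dom) : Prop :=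
  ∀ᵐ t ∂μ, (t ∈ A → D.fn s t = D.fn u t) ∧ (t ∉ A → D.fn s t = -D.fn u t)

/-- The subspace `V` is invariant under the reflection `1_A - 1_{Aᶜ}`, which does not increase the
energy on `V`. -/
def ReflectionInvariant (V : Submodule ℝ D.Dom) (A : Set K) : Prop :=
  ∀ u ∈ V, ∃ s ∈ V, D.Reflects A u s ∧ D.E s s ≤ D.E u u

variable {D}

theorem Reflects.unique {A : Set K} {u s s' : D.Dom} (h : D.Reflects A u s)
    (h' : D.Reflects A u s') : s = s' := by
  refine ext_fn ?_
  filter_upwards [h, h'] with t h1 h2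
  by_cases ht : t ∈ A
  · rw [h1.1 ht, h2.1 ht]
  · rw [h1.2 ht, h2.2 ht]

theorem Reflects.symm {A : Set K} {u s : D.Dom} (h : D.Reflects A u s) : D.Reflects A s u := by
  filter_upwards [h] with t h1
  refine ⟨fun ht => (h1.1 ht).symm, fun ht => ?_⟩
  rw [h1.2 ht, neg_neg]

theorem Reflects.abs_eq {A : Set K} {u s : D.Dom} (h : D.Reflects A u s) :
    ∀ᵐ t ∂μ, |D.fn s t| = |D.fn u t| := by
  filter_upwards [h] with t h1
  by_cases ht : t ∈ A
  · rw [h1.1 ht]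
  · rw [h1.2 ht, abs_neg]

theorem Reflects.norm_le {A : Set K} {u s : D.Dom} (h : D.Reflects A u s)
    (hE : D.E s s ≤ D.E u u) : ‖s‖ ≤ ‖u‖ :=
  D.norm_le_of_le hE (D.norm_toLp_le_of_ae (h.abs_eq.mono fun _ ht => ht.le))

variable {V : Submodule ℝ D.Dom}

theorem ReflectionInvariant.empty : D.ReflectionInvariant V ∅ := fun u hu => by
  refine ⟨-u, neg_mem hu, ?_, (D.E_neg_self u).le⟩
  filter_upwards [D.fn_neg u] with t ht
  exact ⟨fun h => h.elim, fun _ => ht⟩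

theorem ReflectionInvariant.compl {A : Set K} (h : D.ReflectionInvariant V A) :
    D.ReflectionInvariant V Aᶜ := by
  intro u hu
  obtain ⟨s, hs, hr, hE⟩ := h u hu
  refine ⟨-s, neg_mem hs, ?_, (D.E_neg_self s).trans_le hE⟩
  filter_upwards [D.fn_neg s, hr] with t h1 h2
  refine ⟨fun ht => ?_, fun ht => ?_⟩
  · rw [h1, h2.2 ht, neg_neg]
  · rw [h1, h2.1 (not_not.1 ht)]

theorem ReflectionInvariant.congr {A B : Set K} (h : D.ReflectionInvariant V A)
    (hAB : μ (A ∆ B) = 0) : D.ReflectionInvariant V B := by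
  intro u hu
  obtain ⟨s, hs, hr, hE⟩ := h u hu
  refine ⟨s, hs, ?_, hE⟩
  filter_upwards [hr, measure_eq_zero_iff_ae_notMem.1 hAB] with t h1 h2
  have h3 : t ∈ A ↔ t ∈ B := by
    rw [mem_symmDiff] at h2
    tauto
  rwa [h3] at h1

/-- For disjoint sets, the composite of the two reflections is minus the reflection of the union.
This stability is the reason to work with reflections rather than indicators. -/
theorem ReflectionInvariant.union {A B : Set K} (hA : D.ReflectionInvariant V A)
    (hB : D.ReflectionInvariant V B) (hAB : Disjoint A B) : D.ReflectionInvariant V (A ∪ B) := by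
  intro u hu
  obtain ⟨s, hs, hr, hE⟩ := hA u hu
  obtain ⟨s', hs', hr', hE'⟩ := hB s hs
  refine ⟨-s', neg_mem hs', ?_, (D.E_neg_self s').trans_le (hE'.trans hE)⟩
  filter_upwards [D.fn_neg s', hr, hr'] with t h1 h2 h3
  have h4 : ¬ (t ∈ A ∧ t ∈ B) := fun h => hAB.le_bot h
  rw [mem_union]
  by_cases hA : t ∈ A <;> by_cases hB : t ∈ B
  · exact (h4 ⟨hA, hB⟩).elim
  · simp [hA, h1, h2.1 hA, h3.2 hB]
  · simp [hB, h1, h2.2 hA, h3.1 hB]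
  · simp [hA, hB, h1, h2.2 hA, h3.2 hB]

/-- Reflections in the finite partial unions are eventually constant at each point, dominated by
`|u|`, and of energy at most that of `u`. -/
theorem ReflectionInvariant.iUnion (hV : IsClosed (V : Set D.Dom)) {A : ℕ → Set K}
    (hd : Pairwise (Function.onFun Disjoint A)) (h : ∀ n, D.ReflectionInvariant V (A n)) :
    D.ReflectionInvariant V (⋃ n, A n) := by
  have hfin : ∀ n : ℕ, D.ReflectionInvariant V (⋃ i < n, A i) := by
    intro n
    induction n with
    | zero => simpa using ReflectionInvariant.empty
    | succ n ih =>
      rw [biUnion_lt_succ]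
      refine ih.union (h n) ?_
      simp only [disjoint_iUnion_left]
      exact fun i hi => hd hi.ne
  intro u hu
  choose s hs hr hE using fun n => hfin n u hu
  have hr' := ae_all_iff.2 hr
  classical
  obtain ⟨y, hy, hy'⟩ := D.exists_limit_of_dominated s ‖u‖ (fun n => (hr n).norm_le (hE n))
    (g := fun t => if t ∈ ⋃ n, A n then D.fn u t else -D.fn u t) u
    (fun n => (hr n).abs_eq.mono fun _ ht => ht.le) (by
      filter_upwards [hr'] with t ht
      refine tendsto_const_nhds.congr' ?_
      split_ifs with hA
      · obtain ⟨i, hi⟩ := mem_iUnion.1 hA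
        filter_upwards [eventually_gt_atTop i] with n hn
        exact ((ht n).1 (mem_biUnion (show i < n from hn) hi)).symm
      · refine Eventually.of_forall fun n => ((ht n).2 fun h => hA ?_).symm
        obtain ⟨i, -, hi⟩ := mem_iUnion₂.1 h
        exact mem_iUnion.2 ⟨i, hi⟩)
  refine ⟨y, hy' _ hV V.convex (Eventually.of_forall hs), ?_,
    hy' _ (D.isClosed_E_le _) (D.convex_E_le _) (Eventually.of_forall hE)⟩
  filter_upwards [hy] with t ht
  rw [ht]
  exact ⟨fun h => if_pos h, fun h => if_neg h⟩

/-- If `V` is invariant under the reflection of `A`, then multiplication by `1_A` is a projection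
of `V` that is orthogonal for the form. -/
theorem ReflectionInvariant.exists_indicator {A : Set K} (h : D.ReflectionInvariant V A)
    {u : D.Dom} (hu : u ∈ V) :
    ∃ v ∈ V, D.fn v =ᵐ[μ] A.indicator (D.fn u) ∧ D.E v (u - v) = 0 := by
  obtain ⟨s, hs, hr, hE⟩ := h u hu
  -- Reflecting twice returns `u`, so the contraction preserves the energy. Then `1_A u = (u + s)/2`
  -- is orthogonal to `(u - s)/2`, because `E(u + s, u - s) = E(u, u) - E(s, s)`.
  obtain ⟨u', -, hr', hE'⟩ := h s hs
  rw [hr'.unique hr.symm] at hE'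
  refine ⟨(1 / 2 : ℝ) • (u + s), V.smul_mem _ (add_mem hu hs), ?_, ?_⟩
  · filter_upwards [D.fn_smul (1 / 2) (u + s), D.fn_add u s, hr] with t h1 h2 h3
    rw [h1, h2]
    by_cases ht : t ∈ A
    · rw [indicator_of_mem ht, h3.1 ht]
      ring
    · rw [indicator_of_notMem ht, h3.2 ht]
      ring
  · have : u - (1 / 2 : ℝ) • (u + s) = (1 / 2 : ℝ) • (u - s) := by module
    rw [this]
    simp only [map_smul, map_add, map_sub, LinearMap.smul_apply, LinearMap.add_apply, smul_eq_mul]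
    rw [D.E_comm s u]
    linarith

end Reflection

/-! ### Reflections in open pieces, from strong locality -/

section OpenReflection

variable {K : Type*} [TopologicalSpace K] [LocallyCompactSpace K] [T2Space K] [MeasurableSpace K]
  {μ : Measure K} {D : DirichletForm μ}

/-- The part of the support outside `Q` is compact and contained in `P`. A large multiple of a
cutoff of it, in minimum with the positive part of `u`, leaves exactly the restriction to `P`. -/
theorem exists_indicator_pos_mem_core (hreg : D.IsRegular) {P Q : Set K} (hP : IsOpen P)
    (hQ : IsOpen Q) (hPQ : Disjoint P Q) {u : D.Dom} (hu : u ∈ D.core (P ∪ Q)) :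
    ∃ v ∈ D.core P, D.fn v =ᵐ[μ] P.indicator fun t => max 0 (D.fn u t) := by
  obtain ⟨φ, T, h1, h2, h3, h4, h5⟩ := id hu
  obtain ⟨M, hM⟩ := h2.exists_bound_of_continuousOn h1.continuousOn
  have hTP : T \ Q ⊆ P := fun t ht => (h3 ht.1).resolve_right ht.2
  obtain ⟨χ, hχ, O, -, hO, hχ0, hχ1⟩ := exists_cutoff hreg (h2.diff hQ) hP hTP
  have hMχ : |M| • χ ∈ D.core P := (D.core P).smul_mem _ hχ
  refine ⟨_, inf_pos_mem_core hMχ hu, ?_⟩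
  filter_upwards [D.fn_inf (D.pos (|M| • χ)) (D.pos u), D.fn_pos (|M| • χ), D.fn_pos u,
    D.fn_smul |M| χ, fn_eq_zero_of_mem_F0 (core_le_F0 P hMχ), hχ1, h5] with t a b c d e f g
  rw [a, b, c]
  by_cases htP : t ∈ P
  · rw [indicator_of_mem htP]
    by_cases htT : t ∈ T
    · rw [d, f (hO ⟨htT, fun hQ => hPQ.le_bot ⟨htP, hQ⟩⟩), mul_one, g, max_eq_right (abs_nonneg M),
        min_eq_right]
      exact max_le (abs_nonneg _) ((le_abs_self _).trans ((hM t htT).trans (le_abs_self _)))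
    · rw [g, h4 t htT, max_self, min_eq_right (le_max_left _ _)]
  · rw [indicator_of_notMem htP, e htP, max_self, min_eq_left (le_max_left _ _)]

variable [BorelSpace K]

/-- Strong locality makes `1_P u` and `u - 1_P u` orthogonal, so changing the sign of the second
leaves the energy unchanged. -/
theorem exists_reflects_of_mem_core (hreg : D.IsRegular) (hloc : D.IsStronglyLocal) {P Q : Set K}
    (hP : IsOpen P) (hQ : IsOpen Q) (hPQ : Disjoint P Q) {u : D.Dom} (hu : u ∈ D.core (P ∪ Q)) :
    ∃ s ∈ D.core (P ∪ Q), D.Reflects P u s ∧ D.E s s = D.E u u := by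
  obtain ⟨v₁, hv₁, hf₁⟩ := exists_indicator_pos_mem_core hreg hP hQ hPQ hu
  obtain ⟨v₂, hv₂, hf₂⟩ := exists_indicator_pos_mem_core hreg hP hQ hPQ (neg_mem hu)
  obtain ⟨v, hv, hf⟩ : ∃ v ∈ D.core P, D.fn v =ᵐ[μ] P.indicator (D.fn u) := by
    refine ⟨v₁ - v₂, sub_mem hv₁ hv₂, ?_⟩
    filter_upwards [hf₁, hf₂, D.fn_sub v₁ v₂, D.fn_neg u] with t a b c d
    rw [c, a, b]
    by_cases htP : t ∈ P
    · simp only [indicator_of_mem htP, d]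
      rcases le_total 0 (D.fn u t) with h | h
      · rw [max_eq_right h, max_eq_left (by linarith), sub_zero]
      · rw [max_eq_left h, max_eq_right (by linarith)]
        ring
    · simp only [indicator_of_notMem htP, sub_zero]
  have horth : D.E v (u - v) = 0 := by
    refine E_eq_zero_of_mem_F0 hloc hP (core_le_F0 P hv) ?_
    filter_upwards [hf, D.fn_sub u v] with t a b ht
    rw [b, a, indicator_of_mem ht, sub_self]
  refine ⟨v - (u - v), sub_mem (core_mono subset_union_left hv)
    (sub_mem hu (core_mono subset_union_left hv)), ?_, ?_⟩
  · filter_upwards [hf, D.fn_sub v (u - v), D.fn_sub u v] with t a b c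
    refine ⟨fun ht => ?_, fun ht => ?_⟩
    · rw [b, c, a, indicator_of_mem ht, sub_self, sub_zero]
    · rw [b, c, a, indicator_of_notMem ht, sub_zero, zero_sub]
  · have h := D.E_add_self v (u - v)
    rw [add_sub_cancel, horth] at h
    rw [E_sub_self, horth, h]
    ring

theorem exists_reflects_of_mem_F0 (hreg : D.IsRegular) (hloc : D.IsStronglyLocal) {P Q : Set K}
    (hP : IsOpen P) (hQ : IsOpen Q) (hPQ : Disjoint P Q) {u : D.Dom} (hu : u ∈ D.F0 (P ∪ Q)) :
    ∃ s ∈ D.F0 (P ∪ Q), D.Reflects P u s ∧ D.E s s ≤ D.E u u := by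
  obtain ⟨w, hw, hwu⟩ := exists_seq_of_mem_F0 hu
  obtain ⟨C, hC⟩ := exists_norm_le_of_tendsto hwu
  choose s hs hr hE using fun n => exists_reflects_of_mem_core hreg hloc hP hQ hPQ (hw n)
  classical
  obtain ⟨y, hy, hy'⟩ := D.exists_limit_of_abs_le s C
    (fun n => ((hr n).norm_le (hE n).le).trans (hC n))
    (g := P.piecewise (D.fn u) (fun t => -D.fn u t))
    ((D.aestronglyMeasurable_fn u).restrict.piecewise hP.measurableSet
      (D.aestronglyMeasurable_fn u).neg.restrict) (fun n => w n - u) (fun _ => 0)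
    (by simpa using hwu.sub_const u) tendsto_const_nhds (by
      intro n
      filter_upwards [hr n, D.fn_sub (w n) u] with t h1 h2
      refine le_trans (le_of_eq ?_) (le_add_of_nonneg_right (abs_nonneg _))
      rw [h2]
      by_cases ht : t ∈ P
      · rw [piecewise_eq_of_mem _ _ _ ht, h1.1 ht]
      · rw [piecewise_eq_of_notMem _ _ _ ht, h1.2 ht, ← abs_neg]
        ring_nf)
  refine ⟨y, hy' _ (isClosed_F0 _) (D.F0 _).convex
    (Eventually.of_forall fun n => core_le_F0 _ (hs n)), ?_, ?_⟩
  · filter_upwards [hy] with t ht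
    rw [ht]
    exact ⟨fun h => piecewise_eq_of_mem _ _ _ h, fun h => piecewise_eq_of_notMem _ _ _ h⟩
  · refine le_of_forall_gt_imp_ge_of_dense fun a ha => ?_
    refine hy' _ (D.isClosed_E_le a) (D.convex_E_le a) ?_
    have h1 : Tendsto (fun n => D.E (s n) (s n)) atTop (𝓝 (D.E u u)) := by
      simp_rw [hE]
      exact (D.continuous_E_self.tendsto u).comp hwu
    filter_upwards [h1.eventually_lt_const ha] with n hn using hn.le

end OpenReflection

/-! ### Cells and reflection invariance of the null space -/

section CellUnion

variable {K : Type*} {Λ : ℕ → Type*} {U : (n : ℕ) → Λ n → Set K}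

/-- The union of the cells of the `n`-th partition that meet `S`. -/
def cellUnion (U : (n : ℕ) → Λ n → Set K) (S : Set K) (n : ℕ) : Set K :=
  ⋃ k ∈ {k : Λ n | (U n k ∩ S).Nonempty}, U n k

theorem mem_cellUnion {S : Set K} {n : ℕ} {t : K} :
    t ∈ cellUnion U S n ↔ ∃ k, (U n k ∩ S).Nonempty ∧ t ∈ U n k := by
  simp [cellUnion]

end CellUnion

section Cells

variable {K : Type*} [TopologicalSpace K] [MeasurableSpace K] {μ ν : Measure K}
  {Λ : ℕ → Type*} {U : (n : ℕ) → Λ n → Set K}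

theorem isOpen_cellUnion (hU : IsCellPartitionSequence μ ν U) (S : Set K) (n : ℕ) :
    IsOpen (cellUnion U S n) :=
  isOpen_biUnion fun k _ => (hU.partition n).isOpen k

theorem exists_cell_superset (hU : IsCellPartitionSequence μ ν U) {n m : ℕ} (hnm : n ≤ m)
    (k : Λ m) : ∃ k' : Λ n, U m k ⊆ U n k' := by
  induction m, hnm using Nat.le_induction with
  | base => exact ⟨k, Subset.rfl⟩
  | succ m _ ih =>
    obtain ⟨k₁, hk₁⟩ := hU.refine m k
    obtain ⟨k₂, hk₂⟩ := ih k₁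
    exact ⟨k₂, hk₁.trans hk₂⟩

theorem cellUnion_anti (hU : IsCellPartitionSequence μ ν U) (S : Set K) {n m : ℕ} (hnm : n ≤ m) :
    cellUnion U S m ⊆ cellUnion U S n := by
  intro t ht
  obtain ⟨k, hk, htk⟩ := mem_cellUnion.1 ht
  obtain ⟨k', hk'⟩ := exists_cell_superset hU hnm k
  exact mem_cellUnion.2 ⟨k', hk.mono (inter_subset_inter_left _ hk'), hk' htk⟩

theorem cell_subset_or_disjoint (hU : IsCellPartitionSequence μ ν U) {n m : ℕ} (hnm : n ≤ m)
    (l : Λ n) (k : Λ m) : U m k ⊆ U n l ∨ Disjoint (U m k) (U n l) := by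
  obtain ⟨k', hk'⟩ := exists_cell_superset hU hnm k
  by_cases h : k' = l
  · exact Or.inl (h ▸ hk')
  · exact Or.inr (((hU.partition n).disjoint k' l h).mono_left hk')

/-- Two cells are nested or disjoint, so a nonempty intersection is the finer cell. -/
theorem isPiSystem_cells (hU : IsCellPartitionSequence μ ν U) :
    IsPiSystem {s | ∃ (n : ℕ) (k : Λ n), s = U n k} := by
  have key : ∀ n m (k : Λ n) (l : Λ m), n ≤ m → (U n k ∩ U m l).Nonempty →
      U n k ∩ U m l = U m l := by
    intro n m k l hnm hne
    rcases cell_subset_or_disjoint hU hnm k l with h | h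
    · exact inter_eq_right.2 h
    · exact (not_disjoint_iff_nonempty_inter.2 hne h.symm).elim
  rintro _ ⟨n, k, rfl⟩ _ ⟨m, l, rfl⟩ hne
  rcases le_total n m with h | h
  · exact ⟨m, l, key n m k l h hne⟩
  · rw [inter_comm] at hne ⊢
    exact ⟨n, k, key m n l k h hne⟩

/-- The elements of the domain that vanish, in the sense of `F0`, off the union of the cells
of the `n`-th partition that meet `S`, for all `n`. -/
noncomputable def nullSpace (D : DirichletForm μ) (U : (n : ℕ) → Λ n → Set K) (S : Set K) :
    Submodule ℝ D.Dom :=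
  ⨅ n, D.F0 (cellUnion U S n)

variable {D : DirichletForm μ}

theorem mem_nullSpace {S : Set K} {u : D.Dom} :
    u ∈ D.nullSpace U S ↔ ∀ n, u ∈ D.F0 (cellUnion U S n) :=
  Submodule.mem_iInf _

theorem isClosed_nullSpace (S : Set K) : IsClosed (D.nullSpace U S : Set D.Dom) := by
  rw [nullSpace, Submodule.coe_iInf]
  exact isClosed_iInter fun n => isClosed_F0 _

variable [LocallyCompactSpace K] [T2Space K] [BorelSpace K]

theorem reflectionInvariant_cell (hreg : D.IsRegular) (hloc : D.IsStronglyLocal)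
    (hU : IsCellPartitionSequence μ ν U) (S : Set K) (n : ℕ) (l : Λ n) :
    D.ReflectionInvariant (D.nullSpace U S) (U n l) := by
  intro u hu
  rw [mem_nullSpace] at hu
  have key : ∀ m, n ≤ m → ∃ s ∈ D.F0 (cellUnion U S m), D.Reflects (U n l) u s ∧
      D.E s s ≤ D.E u u := by
    intro m hnm
    -- At a finer level, the cells meeting `S` are either inside `U n l` or disjoint from it. As `u`
    -- vanishes off `P ∪ Q`, reflecting in `P` is the same as reflecting in `U n l`.
    let P : Set K := ⋃ k ∈ {k : Λ m | (U m k ∩ S).Nonempty ∧ U m k ⊆ U n l}, U m k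
    let Q : Set K := ⋃ k ∈ {k : Λ m | (U m k ∩ S).Nonempty ∧ Disjoint (U m k) (U n l)}, U m k
    have hP : IsOpen P := isOpen_biUnion fun k _ => (hU.partition m).isOpen k
    have hQ : IsOpen Q := isOpen_biUnion fun k _ => (hU.partition m).isOpen k
    have hPl : P ⊆ U n l := iUnion₂_subset fun k hk => hk.2
    have hQl : Disjoint Q (U n l) := by
      simp only [Q, disjoint_iUnion_left]
      exact fun k hk => hk.2
    have hPQ : P ∪ Q = cellUnion U S m := by
      ext t
      simp only [P, Q, mem_union, mem_iUnion, mem_cellUnion, mem_ofPred_eq, exists_prop]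
      constructor
      · rintro (⟨k, hk, ht⟩ | ⟨k, hk, ht⟩)
        · exact ⟨k, hk.1, ht⟩
        · exact ⟨k, hk.1, ht⟩
      · rintro ⟨k, hk, ht⟩
        rcases cell_subset_or_disjoint hU hnm l k with h | h
        · exact Or.inl ⟨k, ⟨hk, h⟩, ht⟩
        · exact Or.inr ⟨k, ⟨hk, h⟩, ht⟩
    have hum := hu m
    rw [← hPQ] at hum ⊢
    obtain ⟨s, hs, hr, hE⟩ :=
      exists_reflects_of_mem_F0 hreg hloc hP hQ (hQl.symm.mono_left hPl) hum
    refine ⟨s, hs, ?_, hE⟩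
    filter_upwards [hr, fn_eq_zero_of_mem_F0 hum] with t h1 h2
    refine ⟨fun ht => ?_, fun ht => h1.2 fun h => ht (hPl h)⟩
    by_cases htP : t ∈ P
    · exact h1.1 htP
    · have h3 := h2 fun h => h.elim htP fun h => hQl.le_bot ⟨h, ht⟩
      rw [h1.2 htP, h3, neg_zero]
  -- The reflected function is unique, so the same `s` serves at all levels; levels below `n` follow
  -- by monotonicity of `F0`.
  obtain ⟨s, -, hr, hE⟩ := key n le_rfl
  refine ⟨s, mem_nullSpace.2 fun m => ?_, hr, hE⟩
  obtain ⟨s', hs', hr', -⟩ := key (max n m) (le_max_left _ _)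
  rw [hr.unique hr']
  exact F0_mono (cellUnion_anti hU S (le_max_right _ _)) hs'

/-- Invariant sets contain the cells and are stable under complements, countable disjoint unions and
null modifications, so the π-λ theorem applies. -/
theorem reflectionInvariant_nullSpace (hreg : D.IsRegular) (hloc : D.IsStronglyLocal)
    (hU : IsCellPartitionSequence μ ν U) (S : Set K) {A : Set K} (hA : MeasurableSet A) :
    D.ReflectionInvariant (D.nullSpace U S) A := by
  obtain ⟨A', hA', hAA'⟩ := hU.generate A hA
  have h0 : μ (A' ∆ A) = 0 := by
    rw [symmDiff_comm]
    rw [Measure.add_apply] at hAA'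
    exact (add_eq_zero.1 hAA').1
  refine ReflectionInvariant.congr ?_ h0
  clear hAA' h0
  induction A', hA' using MeasurableSpace.induction_on_inter rfl (isPiSystem_cells hU) with
  | empty => exact ReflectionInvariant.empty
  | basic s hs =>
    obtain ⟨n, k, rfl⟩ := hs
    exact reflectionInvariant_cell hreg hloc hU S n k
  | compl s _ ih => exact ih.compl
  | iUnion f hd _ ih => exact ReflectionInvariant.iUnion (isClosed_nullSpace S) hd ih

end Cells

end DirichletForm

/-! ### The functional `E(b, ·)` for an indicator `b` -/

namespace DirichletForm

section Indicator

variable {K : Type*} [MeasurableSpace K] {μ : Measure K} {D : DirichletForm μ}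

theorem fn_sum {ι : Type*} (s : Finset ι) (u : ι → D.Dom) :
    D.fn (∑ i ∈ s, u i) =ᵐ[μ] fun t => ∑ i ∈ s, D.fn (u i) t := by
  classical
  induction s using Finset.induction_on with
  | empty => simpa using D.fn_zero
  | insert i s hi ih =>
    rw [Finset.sum_insert hi]
    filter_upwards [D.fn_add (u i) (∑ i ∈ s, u i), ih] with t h1 h2
    rw [h1, h2, Finset.sum_insert hi]

theorem exists_norm_toLp_le {W : Set K} (hW : MeasurableSet W) (hμW : μ W < ∞) (M : ℝ) :
    ∃ R : ℝ, ∀ h : D.Dom, (∀ᵐ t ∂μ, |D.fn h t| ≤ M) → (∀ᵐ t ∂μ, t ∉ W → D.fn h t = 0) →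
      ‖D.toLp h‖ ≤ R := by
  refine ⟨‖indicatorConstLp 2 hW hμW.ne M‖, fun h hM h0 => ?_⟩
  refine Lp.norm_le_norm_of_ae_le ?_
  filter_upwards [hM, h0, indicatorConstLp_coeFn (p := 2) (hs := hW) (hμs := hμW.ne) (c := M)]
    with t a b c
  rw [c]
  by_cases ht : t ∈ W
  · rw [indicator_of_mem ht]
    exact a.trans (le_abs_self M)
  · rw [← fn_eq, b ht, norm_zero]
    exact norm_nonneg _

/-- Truncation does not increase energy, so `E(b, b) ≤ E(b + t q, b + t q)`; this is a first-order
condition as `t → 0`. -/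
theorem E_nonneg_of_trunc_eq {b q : D.Dom} (h : ∀ t : ℝ, 0 < t → D.trunc 1 (b + t • q) = b) :
    0 ≤ D.E b q := by
  by_contra! hlt
  have hq := D.E_nonneg q
  have key : ∀ t : ℝ, 0 < t → 0 ≤ 2 * D.E b q + t * D.E q q := by
    intro t ht
    have h1 := D.E_trunc_le one_pos (b + t • q)
    rw [h t ht, E_add_self, E_smul_self, map_smul, smul_eq_mul] at h1
    have h2 : 0 ≤ t * (2 * D.E b q + t * D.E q q) := by linarith
    exact nonneg_of_mul_nonneg_right h2 ht
  -- This `t` makes `t E(q, q) ≤ -E(b, q)`, so the bound in `key` becomes at most `E(b, q) < 0`. The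
  -- `+ 1` keeps the denominator positive.
  have h3 := key (-D.E b q / (D.E q q + 1)) (div_pos (by linarith) (by linarith))
  have h4 : -D.E b q / (D.E q q + 1) * D.E q q ≤ -D.E b q := by
    rw [div_mul_eq_mul_div, div_le_iff₀ (by linarith)]
    nlinarith
  linarith

/-- Raising `b` on `{b = 1}` is undone by truncation to `[0, 1]`. -/
theorem E_indicator_nonneg {b q : D.Dom} (hb : ∀ᵐ t ∂μ, D.fn b t = 0 ∨ D.fn b t = 1)
    (hq : ∀ᵐ t ∂μ, 0 ≤ D.fn q t) (hbq : ∀ᵐ t ∂μ, D.fn b t = 0 → D.fn q t = 0) :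
    0 ≤ D.E b q := by
  refine E_nonneg_of_trunc_eq fun s hs => ext_fn ?_
  filter_upwards [hb, hq, hbq, D.fn_trunc one_pos (b + s • q), D.fn_add b (s • q), D.fn_smul s q]
    with t h1 h2 h3 h4 h5 h6
  rw [h4, h5, h6]
  have h7 := mul_nonneg hs.le h2
  rcases h1 with h1 | h1
  · simp [h1, h3 h1]
  · rw [h1, max_eq_right (by linarith), min_eq_right (by linarith)]

/-- Lowering `b` where it is `0` is undone by truncation to `[0, 1]`. -/
theorem E_indicator_nonpos {b q : D.Dom} (hb : ∀ᵐ t ∂μ, D.fn b t = 0 ∨ D.fn b t = 1)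
    (hq : ∀ᵐ t ∂μ, 0 ≤ D.fn q t) (hbq : ∀ᵐ t ∂μ, D.fn b t = 1 → D.fn q t = 0) :
    D.E b q ≤ 0 := by
  have h : 0 ≤ D.E b (-q) := by
    refine E_nonneg_of_trunc_eq fun s hs => ext_fn ?_
    filter_upwards [hb, hq, hbq, D.fn_trunc one_pos (b + s • -q), D.fn_add b (s • -q),
      D.fn_smul s (-q), D.fn_neg q] with t h1 h2 h3 h4 h5 h6 h6'
    rw [h4, h5, h6, h6']
    have h7 := mul_nonneg hs.le h2
    rcases h1 with h1 | h1
    · rw [h1, max_eq_left (by linarith), min_eq_left zero_le_one]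
    · simp [h1, h3 h1]
  rw [map_neg] at h
  linarith

/-- If `b` is an indicator function, `χ = 1` on `{b = 1}` and `E(b, χ) = 0`, then `E(b, ·)` is
controlled by the supremum norm. -/
theorem abs_E_indicator_le {b χ v : D.Dom} {δ : ℝ} (hδ : 0 ≤ δ)
    (hb : ∀ᵐ t ∂μ, D.fn b t = 0 ∨ D.fn b t = 1) (hχ : ∀ᵐ t ∂μ, D.fn b t = 1 → D.fn χ t = 1)
    (hbχ : D.E b χ = 0) (hv : ∀ᵐ t ∂μ, |D.fn v t| ≤ δ * D.fn χ t) :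
    |D.E b v| ≤ 2 * δ * D.E b b := by
  -- Since `E(b, χ) = 0`, `v` may be replaced by `p`, with `0 ≤ p ≤ 2δχ`. Split `p` into `q₁` on `{b
  -- = 1}` and `q₂` off it. The sign rules give `0 ≤ E(b, q₁) ≤ 2δ E(b, b)` by comparison with `2δ
  -- b`, and `-2δ E(b, b) ≤ E(b, q₂) ≤ 0` by comparison with `2δ (χ - b)`.
  set p := v + δ • χ with hp
  set q₁ := D.inf p ((2 * δ) • b) with hq₁
  set q₂ := p - q₁ with hq₂
  have hfp : ∀ᵐ t ∂μ, 0 ≤ D.fn p t ∧ D.fn p t ≤ 2 * δ * D.fn χ t := by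
    filter_upwards [hv, D.fn_add v (δ • χ), D.fn_smul δ χ] with t h1 h2 h3
    rw [h2, h3]
    have := abs_le.1 h1
    constructor <;> linarith
  have hf1 : D.fn q₁ =ᵐ[μ] fun t => min (D.fn p t) (2 * δ * D.fn b t) := by
    filter_upwards [D.fn_inf p ((2 * δ) • b), D.fn_smul (2 * δ) b] with t h1 h2
    rw [h1, h2]
  have hf2 : D.fn q₂ =ᵐ[μ] fun t => D.fn p t - D.fn q₁ t := D.fn_sub _ _
  have hf3 : D.fn ((2 * δ) • b - q₁) =ᵐ[μ] fun t => 2 * δ * D.fn b t - D.fn q₁ t := by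
    filter_upwards [D.fn_sub ((2 * δ) • b) q₁, D.fn_smul (2 * δ) b] with t h1 h2
    rw [h1, h2]
  have hf4 : D.fn ((2 * δ) • (χ - b) - q₂) =ᵐ[μ]
      fun t => 2 * δ * (D.fn χ t - D.fn b t) - D.fn q₂ t := by
    filter_upwards [D.fn_sub ((2 * δ) • (χ - b)) q₂, D.fn_smul (2 * δ) (χ - b), D.fn_sub χ b]
      with t h1 h2 h3
    rw [h1, h2, h3]
  have e1 : 0 ≤ D.E b q₁ := by
    refine E_indicator_nonneg hb ?_ ?_
    · filter_upwards [hf1, hfp, hb] with t h1 h2 h3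
      rw [h1]
      refine le_min h2.1 ?_
      rcases h3 with h3 | h3 <;> rw [h3] <;> linarith
    · filter_upwards [hf1, hfp] with t h1 h2 h3
      rw [h1, h3, mul_zero, min_eq_right h2.1]
  have e2 : 0 ≤ D.E b ((2 * δ) • b - q₁) := by
    refine E_indicator_nonneg hb ?_ ?_
    · filter_upwards [hf1, hf3] with t h1 h2
      rw [h2, h1]
      linarith [min_le_right (D.fn p t) (2 * δ * D.fn b t)]
    · filter_upwards [hf1, hf3, hfp] with t h1 h2 h4 h3
      rw [h2, h1, h3, mul_zero, min_eq_right h4.1, sub_zero]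
  have e3 : D.E b q₂ ≤ 0 := by
    refine E_indicator_nonpos hb ?_ ?_
    · filter_upwards [hf1, hf2] with t h1 h2
      rw [h2, h1]
      linarith [min_le_left (D.fn p t) (2 * δ * D.fn b t)]
    · filter_upwards [hf1, hf2, hfp, hχ] with t h1 h2 h3 h4 h5
      rw [h4 h5] at h3
      rw [h2, h1, h5, min_eq_left h3.2, sub_self]
  have e4 : D.E b ((2 * δ) • (χ - b) - q₂) ≤ 0 := by
    refine E_indicator_nonpos hb ?_ ?_
    · filter_upwards [hf1, hf2, hf4, hfp, hχ, hb] with t h1 h2 h4 h3 h5 h6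
      rw [h4, h2, h1]
      rcases h6 with h6 | h6
      · rw [h6, mul_zero, min_eq_right h3.1]
        linarith
      · have h7 := h5 h6
        rw [h7] at h3
        rw [h6, h7, min_eq_left h3.2]
        linarith
    · filter_upwards [hf1, hf2, hf4, hfp, hχ] with t h1 h2 h4 h3 h5 h6
      have h7 := h5 h6
      rw [h7] at h3
      rw [h4, h2, h1, h6, h7, min_eq_left h3.2]
      ring
  have e5 : D.E b v = D.E b q₁ + D.E b q₂ := by
    rw [hq₂, hp]
    simp only [map_add, map_sub, map_smul, hbχ, smul_eq_mul]
    ring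
  simp only [map_sub, map_smul, smul_eq_mul, hbχ] at e2 e4
  rw [e5, abs_le]
  constructor <;> linarith

theorem E_eq_zero_of_disjoint {V : Submodule ℝ D.Dom} {A B : Set K}
    (hA : D.ReflectionInvariant V A) (hAB : Disjoint A B) {f : K → ℝ} {v w : D.Dom} (hv : v ∈ V)
    (hw : w ∈ V) (hfv : D.fn v =ᵐ[μ] A.indicator f) (hfw : D.fn w =ᵐ[μ] B.indicator f) :
    D.E v w = 0 := by
  obtain ⟨v', -, hfv', hE⟩ := hA.exists_indicator (add_mem hv hw)
  have : v' = v := by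
    refine ext_fn ?_
    filter_upwards [hfv', hfv, hfw, D.fn_add v w] with t h1 h2 h3 h4
    rw [h1, h2]
    by_cases ht : t ∈ A
    · rw [indicator_of_mem ht, indicator_of_mem ht, h4, h2, h3, indicator_of_mem ht,
        indicator_of_notMem fun h => hAB.le_bot ⟨ht, h⟩, add_zero]
    · rw [indicator_of_notMem ht, indicator_of_notMem ht]
  rwa [this, add_sub_cancel_left] at hE

end Indicator

/-! ### Bounded elements of a reflection-invariant solid subspace have no energy -/

section ZeroEnergy

variable {K : Type*} [TopologicalSpace K] [LocallyCompactSpace K] [T2Space K] [MeasurableSpace K]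
  [BorelSpace K] {μ : Measure K} {D : DirichletForm μ} {V : Submodule ℝ D.Dom}

theorem E_indicator_core_eq_zero (hreg : D.IsRegular) (hloc : D.IsStronglyLocal)
    (hV : ∀ A : Set K, MeasurableSet A → D.ReflectionInvariant V A) {e : D.Dom} (he : e ∈ V)
    (he01 : ∀ᵐ t ∂μ, D.fn e t = 0 ∨ D.fn e t = 1) {φ : D.Dom} (hφ : φ ∈ D.core univ) :
    D.E e φ = 0 := by
  obtain ⟨f, T, h1, h2, -, h4, h5⟩ := hφ
  obtain ⟨M, hM⟩ := h2.exists_bound_of_continuousOn h1.continuousOn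
  have hfM : ∀ t, |f t| ≤ |M| := by
    intro t
    by_cases ht : t ∈ T
    · exact (hM t ht).trans (le_abs_self M)
    · rw [h4 t ht, abs_zero]
      exact abs_nonneg _
  -- Restricting `e` to a compact neighborhood of the support of `φ` leaves `E(e, φ)` unchanged by
  -- locality, and provides a cutoff `χ` equal to `1` near every slice.
  obtain ⟨C, hC, hTC⟩ := exists_compact_superset h2
  have hCm : MeasurableSet C := hC.isClosed.measurableSet
  obtain ⟨e', he', hfe', -⟩ := (hV C hCm).exists_indicator he
  have hred : D.E e φ = D.E e' φ := by
    have h : D.E φ (e - e') = 0 := by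
      refine E_eq_zero_of_const_near (c := 0) hloc h2.isClosed ?_ isOpen_interior hTC ?_
      · filter_upwards [h5] with t ht htT
        rw [ht, h4 t htT]
      · filter_upwards [hfe', D.fn_sub e e'] with t a b ht
        rw [b, a, indicator_of_mem (interior_subset ht), sub_self]
    rw [map_sub, sub_eq_zero] at h
    rw [D.E_comm e, D.E_comm e', h]
  obtain ⟨χ, -, O, hO, hCO, hχ0, hχ1⟩ := exists_cutoff hreg hC isOpen_univ (subset_univ _)
  have key : ∀ δ : ℝ, 0 < δ → |D.E e' φ| ≤ δ * (4 * D.E e' e') := by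
    intro δ hδ
    -- Slices of `C` on which `φ` varies by less than `δ`; finitely many cover `C` because `φ` is
    -- bounded.
    let B : ℤ → Set K := fun j => C ∩ {t | ⌊f t / δ⌋ = j}
    have hBm : ∀ j, MeasurableSet (B j) := fun j =>
      hCm.inter ((h1.measurable.div_const δ).floor (measurableSet_singleton j))
    have hBd : ∀ i j, i ≠ j → Disjoint (B i) (B j) := fun i j hij =>
      disjoint_left.2 fun t hi hj => hij (hi.2.symm.trans hj.2)
    choose b hb hfb _ using fun j => (hV (B j) (hBm j)).exists_indicator he
    have horth : ∀ i j, i ≠ j → D.E (b i) (b j) = 0 := fun i j hij =>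
      E_eq_zero_of_disjoint (hV _ (hBm i)) (hBd i j hij) (hb i) (hb j) (hfb i) (hfb j)
    obtain ⟨N, hN⟩ := exists_nat_ge (|M| / δ + 1)
    set J : Finset ℤ := Finset.Icc (-N) N with hJ
    have hmem : ∀ t, ⌊f t / δ⌋ ∈ J := by
      intro t
      have a := abs_le.1 (hfM t)
      have b1 : f t / δ ≤ |M| / δ := by gcongr; exact a.2
      have b2 : -(|M| / δ) ≤ f t / δ := by
        rw [← neg_div]
        gcongr
        exact a.1
      rw [hJ, Finset.mem_Icc]
      constructor
      · rw [Int.le_floor]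
        push_cast
        linarith
      · have := Int.floor_le (f t / δ)
        have h : (⌊f t / δ⌋ : ℝ) ≤ N := by linarith
        exact_mod_cast h
    have hsum : e' = ∑ j ∈ J, b j := by
      refine ext_fn ?_
      have hfb' := ae_all_iff.2 hfb
      filter_upwards [hfe', fn_sum J b, hfb'] with t a c d
      rw [a, c]
      simp_rw [d]
      by_cases ht : t ∈ C
      · rw [indicator_of_mem ht, Finset.sum_eq_single ⌊f t / δ⌋]
        · rw [indicator_of_mem]
          exact ⟨ht, rfl⟩
        · intro j _ hj
          exact indicator_of_notMem (fun h => hj h.2.symm) _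
        · exact fun h => (h (hmem t)).elim
      · rw [indicator_of_notMem ht, Finset.sum_eq_zero]
        exact fun j _ => indicator_of_notMem (fun h => ht h.1) _
    have hEsum : D.E e' e' = ∑ j ∈ J, D.E (b j) (b j) := by
      rw [hsum]
      simp only [map_sum, LinearMap.sum_apply]
      refine Finset.sum_congr rfl fun i hi => ?_
      exact Finset.sum_eq_single_of_mem i hi fun j _ hj => horth j i hj
    have hbj : ∀ j, |D.E (b j) φ| ≤ 4 * δ * D.E (b j) (b j) := by
      intro j
      have hclosed : IsClosed (C ∩ f ⁻¹' Icc (j * δ) ((j + 1) * δ)) :=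
        hC.isClosed.inter (isClosed_Icc.preimage h1)
      have hopen : IsOpen (O ∩ f ⁻¹' Ioo ((j - 1) * δ) ((j + 2) * δ)) :=
        hO.inter (isOpen_Ioo.preimage h1)
      have hsub : C ∩ f ⁻¹' Icc (j * δ) ((j + 1) * δ)
          ⊆ O ∩ f ⁻¹' Ioo ((j - 1) * δ) ((j + 2) * δ) := by
        rintro t ⟨htC, ht⟩
        exact ⟨hCO htC, by nlinarith [ht.1], by nlinarith [ht.2]⟩
      have hvan : ∀ᵐ t ∂μ, t ∉ C ∩ f ⁻¹' Icc (j * δ) ((j + 1) * δ) → D.fn (b j) t = 0 := by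
        filter_upwards [hfb j] with t a ht
        rw [a]
        refine indicator_of_notMem (fun h => ht ⟨h.1, ?_⟩) _
        have h3 : ⌊f t / δ⌋ = j := h.2
        rw [Int.floor_eq_iff, le_div_iff₀ hδ, div_lt_iff₀ hδ] at h3
        exact ⟨h3.1, h3.2.le⟩
      have hb01 : ∀ᵐ t ∂μ, D.fn (b j) t = 0 ∨ D.fn (b j) t = 1 := by
        filter_upwards [hfb j, he01] with t a c
        rw [a]
        by_cases ht : t ∈ B j
        · rwa [indicator_of_mem ht]
        · exact Or.inl (indicator_of_notMem ht _)
      have hbχ : D.E (b j) χ = 0 := by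
        refine E_eq_zero_of_const_near (c := 1) hloc hclosed hvan hopen hsub ?_
        filter_upwards [hχ1] with t a ht using a ht.1
      set x := φ - (j * δ) • χ with hx
      set v := -D.inf (-D.inf x ((2 * δ) • χ)) ((2 * δ) • χ) with hv
      have hfx : D.fn x =ᵐ[μ] fun t => f t - j * δ * D.fn χ t := by
        filter_upwards [h5, D.fn_sub φ ((j * δ) • χ), D.fn_smul (j * δ) χ] with t a b c
        rw [b, a, c]
      have hfv : D.fn v =ᵐ[μ] fun t =>
          -min (-min (D.fn x t) (2 * δ * D.fn χ t)) (2 * δ * D.fn χ t) := by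
        filter_upwards [D.fn_neg (D.inf (-D.inf x ((2 * δ) • χ)) ((2 * δ) • χ)),
          D.fn_inf (-D.inf x ((2 * δ) • χ)) ((2 * δ) • χ), D.fn_neg (D.inf x ((2 * δ) • χ)),
          D.fn_inf x ((2 * δ) • χ), D.fn_smul (2 * δ) χ] with t a b c d e
        rw [a, b, c, d, e]
      have hEv : D.E (b j) φ = D.E (b j) v := by
        have h : D.E (b j) (x - v) = 0 := by
          refine E_eq_zero_of_const_near (c := 0) hloc hclosed hvan hopen hsub ?_
          filter_upwards [hfx, hfv, hχ1, D.fn_sub x v] with t a c d e ht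
          have h6 := ht.2.1
          have h7 := ht.2.2
          have h8 : f t - j * δ * 1 ≤ 2 * δ * 1 := by linarith
          rw [e, c, a, d ht.1, min_eq_left h8, min_eq_left (by linarith)]
          ring
        rw [hx] at h
        simp only [map_sub, map_smul, hbχ, smul_zero, sub_zero] at h
        linarith
      have h6 := abs_E_indicator_le (δ := 2 * δ) (by positivity) hb01 (χ := χ) (v := v) (by
          filter_upwards [hvan, hχ1] with t a c ht
          by_contra h
          have h7 := a fun h' => h (c (hsub h').1)
          rw [ht] at h7
          exact one_ne_zero h7) hbχ (by
          filter_upwards [hfv, hχ0] with t a c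
          have h8 : 0 ≤ 2 * δ * D.fn χ t := by positivity
          rw [a, abs_neg, abs_le]
          refine ⟨le_min ?_ (by linarith), min_le_right _ _⟩
          exact neg_le_neg (min_le_right _ _))
      rw [hEv]
      linarith
    have h0 : D.E e' φ = ∑ j ∈ J, D.E (b j) φ := by
      rw [hsum]
      simp only [map_sum, LinearMap.sum_apply]
    calc |D.E e' φ| ≤ ∑ j ∈ J, |D.E (b j) φ| := by
          rw [h0]
          exact Finset.abs_sum_le_sum_abs _ _
      _ ≤ ∑ j ∈ J, 4 * δ * D.E (b j) (b j) := Finset.sum_le_sum fun j _ => hbj j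
      _ = δ * (4 * D.E e' e') := by
          rw [← Finset.mul_sum, ← hEsum]
          ring
  rw [hred, ← abs_eq_zero]
  refine le_antisymm ?_ (abs_nonneg _)
  have hlim : Tendsto (fun δ : ℝ => δ * (4 * D.E e' e')) (𝓝[>] 0) (𝓝 0) := by
    have : Tendsto (fun δ : ℝ => δ * (4 * D.E e' e')) (𝓝 0) (𝓝 (0 * (4 * D.E e' e'))) :=
      (continuous_id.mul continuous_const).tendsto 0
    rw [zero_mul] at this
    exact this.mono_left nhdsWithin_le_nhds
  exact ge_of_tendsto hlim (eventually_mem_nhdsWithin.mono key)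

/-- A binary expansion: subtract `c · 1_{r > c}` with `c = M / 2 ^ (n + 1)` from the remainder `r`,
halving its upper bound. Each subtracted term has no energy, so `u` is a weak limit of functions
without energy. -/
theorem E_nonneg_bounded_eq_zero (hreg : D.IsRegular) (hloc : D.IsStronglyLocal)
    (hV : ∀ A : Set K, MeasurableSet A → D.ReflectionInvariant V A)
    (hideal : ∀ u ∈ V, ∀ v : D.Dom, (∀ᵐ t ∂μ, |D.fn v t| ≤ |D.fn u t|) → v ∈ V)
    {u : D.Dom} (hu : u ∈ V) (hu0 : ∀ᵐ t ∂μ, 0 ≤ D.fn u t) {M : ℝ} (hM : 0 < M)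
    (huM : ∀ᵐ t ∂μ, D.fn u t ≤ M) (w : D.Dom) : D.E u w = 0 := by
  have hind : ∀ r ∈ V, ∀ c : ℝ, 0 < c → ∃ v ∈ V,
      D.fn v =ᵐ[μ] {t | c < D.fn r t}.indicator (fun _ => c) ∧ ∀ w, D.E v w = 0 := by
    intro r hr c hc
    have hm : MeasurableSet {t | c < D.fn r t} :=
      measurableSet_lt measurable_const (Lp.stronglyMeasurable (D.toLp r)).measurable
    obtain ⟨v, hv, hfv, -⟩ := (hV _ hm).exists_indicator hr
    have hf : D.fn (D.trunc c v) =ᵐ[μ] {t | c < D.fn r t}.indicator (fun _ => c) := by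
      filter_upwards [D.fn_trunc hc v, hfv] with t a b
      rw [a, b]
      by_cases ht : c < D.fn r t
      · rw [indicator_of_mem (show t ∈ {t | c < D.fn r t} from ht),
          indicator_of_mem (show t ∈ {t | c < D.fn r t} from ht),
          max_eq_right (hc.trans ht).le, min_eq_right ht.le]
      · rw [indicator_of_notMem (show t ∉ {t | c < D.fn r t} from ht),
          indicator_of_notMem (show t ∉ {t | c < D.fn r t} from ht), max_self, min_eq_left hc.le]
    have hmem : D.trunc c v ∈ V := by
      refine hideal v hv _ ?_
      filter_upwards [D.fn_trunc hc v] with t a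
      rw [a, abs_of_nonneg (le_min (le_max_left _ _) hc.le)]
      exact (min_le_left _ _).trans (max_le (abs_nonneg _) (le_abs_self _))
    refine ⟨_, hmem, hf, fun w => ?_⟩
    have h01 : ∀ᵐ t ∂μ, D.fn (c⁻¹ • D.trunc c v) t = 0 ∨ D.fn (c⁻¹ • D.trunc c v) t = 1 := by
      filter_upwards [hf, D.fn_smul c⁻¹ (D.trunc c v)] with t a b
      rw [b, a]
      by_cases ht : t ∈ {t | c < D.fn r t}
      · rw [indicator_of_mem ht, inv_mul_cancel₀ hc.ne']
        exact Or.inr rfl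
      · rw [indicator_of_notMem ht, mul_zero]
        exact Or.inl rfl
    have h2 := E_eq_zero_of_core hreg (fun φ hφ => E_indicator_core_eq_zero hreg hloc hV
      (V.smul_mem c⁻¹ hmem) h01 hφ) w
    rw [map_smul, LinearMap.smul_apply, smul_eq_mul] at h2
    exact (mul_eq_zero.1 h2).resolve_left (inv_ne_zero hc.ne')
  have hr : ∀ n : ℕ, ∃ r ∈ V, (∀ᵐ t ∂μ, 0 ≤ D.fn r t ∧ D.fn r t ≤ D.fn u t ∧
      D.fn r t ≤ M / 2 ^ n) ∧ ∀ w, D.E (u - r) w = 0 := by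
    intro n
    induction n with
    | zero =>
      refine ⟨u, hu, ?_, fun w => by simp⟩
      filter_upwards [hu0, huM] with t a b
      exact ⟨a, le_rfl, by simpa using b⟩
    | succ n ih =>
      obtain ⟨r, hrV, hr, hE⟩ := ih
      have hc : 0 < M / 2 ^ (n + 1) := by positivity
      obtain ⟨v, hv, hfv, hEv⟩ := hind r hrV _ hc
      refine ⟨r - v, sub_mem hrV hv, ?_, fun w => ?_⟩
      · have h2 : M / 2 ^ n = 2 * (M / 2 ^ (n + 1)) := by
          field_simp
          ring
        filter_upwards [hr, hfv, D.fn_sub r v] with t a b c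
        rw [c, b]
        by_cases ht : M / 2 ^ (n + 1) < D.fn r t
        · rw [indicator_of_mem (show t ∈ {t | M / 2 ^ (n + 1) < D.fn r t} from ht)]
          exact ⟨by linarith, by linarith [a.2.1], by linarith [a.2.2]⟩
        · rw [indicator_of_notMem (show t ∉ {t | M / 2 ^ (n + 1) < D.fn r t} from ht), sub_zero]
          exact ⟨a.1, a.2.1, not_lt.1 ht⟩
      · have h3 := hE w
        have h4 := hEv w
        simp only [map_sub, LinearMap.sub_apply] at h3 ⊢
        linarith
  choose r hrV hr hE using hr
  have hr' := ae_all_iff.2 hr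
  obtain ⟨y, hy, hy'⟩ := D.exists_limit_of_dominated (fun n => u - r n) ‖u‖ (fun n => by
      refine D.norm_le_of_le ?_ (D.norm_toLp_le_of_ae ?_)
      · rw [hE n]
        exact D.E_nonneg u
      · filter_upwards [hr n, D.fn_sub u (r n)] with t a b
        rw [b, abs_of_nonneg (by linarith), abs_of_nonneg (by linarith)]
        linarith) (g := D.fn u) u (by
      intro n
      filter_upwards [hr n, D.fn_sub u (r n)] with t a b
      rw [b, abs_of_nonneg (by linarith), abs_of_nonneg (by linarith)]
      linarith) (by
      filter_upwards [hr', ae_all_iff.2 fun n => D.fn_sub u (r n)] with t a b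
      simp_rw [b]
      have h0 : Tendsto (fun n => D.fn (r n) t) atTop (𝓝 0) := by
        refine squeeze_zero (fun n => (a n).1) (fun n => (a n).2.2) ?_
        have h := (tendsto_pow_atTop_nhds_zero_of_lt_one (r := (1 / 2 : ℝ)) (by norm_num)
          (by norm_num)).const_mul M
        rw [mul_zero] at h
        refine h.congr fun n => ?_
        rw [one_div, inv_pow, div_eq_mul_inv]
      simpa using h0.const_sub (D.fn u t))
  have h0 : D.E y y ≤ 0 := hy' _ (D.isClosed_E_le 0) (D.convex_E_le 0)
    (Eventually.of_forall fun n => (hE n _).le)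
  rw [ext_fn hy] at h0
  exact D.E_eq_zero_of_self (le_antisymm h0 (D.E_nonneg u)) w

/-- Bounded elements of a solid subspace that is invariant under all reflections have no energy. -/
theorem E_bounded_eq_zero (hreg : D.IsRegular) (hloc : D.IsStronglyLocal)
    (hV : ∀ A : Set K, MeasurableSet A → D.ReflectionInvariant V A)
    (hideal : ∀ u ∈ V, ∀ v : D.Dom, (∀ᵐ t ∂μ, |D.fn v t| ≤ |D.fn u t|) → v ∈ V)
    {u : D.Dom} (hu : u ∈ V) {M : ℝ} (hM : 0 < M) (huM : ∀ᵐ t ∂μ, |D.fn u t| ≤ M) (w : D.Dom) :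
    D.E u w = 0 := by
  have key : ∀ u ∈ V, (∀ᵐ t ∂μ, |D.fn u t| ≤ M) → D.E (D.pos u) w = 0 := by
    intro u hu huM
    refine E_nonneg_bounded_eq_zero hreg hloc hV hideal (hideal u hu _ ?_) ?_ hM ?_ w
    · filter_upwards [D.fn_pos u] with t a
      rw [a, abs_of_nonneg (le_max_left _ _)]
      exact max_le (abs_nonneg _) (le_abs_self _)
    · filter_upwards [D.fn_pos u] with t a
      rw [a]
      exact le_max_left _ _
    · filter_upwards [D.fn_pos u, huM] with t a b
      rw [a]
      exact max_le hM.le ((le_abs_self _).trans b)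
  have h1 := key u hu huM
  have h2 := key (-u) (neg_mem hu) (by
    filter_upwards [D.fn_neg u, huM] with t a b
    rwa [a, abs_neg])
  rw [← D.pos_sub_pos_neg u, map_sub, LinearMap.sub_apply, h1, h2, sub_zero]

end ZeroEnergy

end DirichletForm

/-! ### Bounded energy minimizers -/

namespace DirichletForm

section Minimizer

variable {K : Type*} [TopologicalSpace K] [MeasurableSpace K] {μ : Measure K}
  {D : DirichletForm μ}

/-- Existence of a bounded energy minimizer with prescribed values off an open set of finite
measure. -/
theorem exists_minimizer (hreg : D.IsRegular) {W : Set K} {f : D.Dom} {M R : ℝ} (hM : 0 < M)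
    (hf : ∀ᵐ t ∂μ, D.fn f t ∈ Icc 0 M) (hfW : ∀ᵐ t ∂μ, t ∉ W → D.fn f t = 0)
    (hR : ∀ h : D.Dom, (∀ᵐ t ∂μ, |D.fn h t| ≤ M) → (∀ᵐ t ∂μ, t ∉ W → D.fn h t = 0) →
      ‖D.toLp h‖ ≤ R) :
    ∃ h : D.Dom, f - h ∈ D.F0 W ∧ (∀ᵐ t ∂μ, D.fn h t ∈ Icc 0 M) ∧
      ‖h‖ ≤ √(D.E f f + R ^ 2) ∧ ∀ ψ ∈ D.F0 W, D.E h ψ = 0 := by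
  let S : Set D.Dom := {h | f - h ∈ D.F0 W} ∩ {h | ∀ᵐ t ∂μ, D.fn h t ∈ Icc 0 M}
  have hfS : f ∈ S := ⟨by simp, hf⟩
  have hclosed : IsClosed S :=
    ((isClosed_F0 W).preimage (continuous_const.sub continuous_id)).inter
      (D.isClosed_ae_mem _ fun _ => isClosed_Icc)
  have hconv : Convex ℝ S := by
    refine Convex.inter ?_ (D.convex_ae_mem _ fun _ => convex_Icc 0 M)
    intro u hu v hv a b ha hb hab
    have h1 : f - (a • u + b • v) = a • (f - u) + b • (f - v) := by
      rw [show b = 1 - a by linarith]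
      module
    change f - (a • u + b • v) ∈ D.F0 W
    rw [h1]
    exact add_mem ((D.F0 W).smul_mem a hu) ((D.F0 W).smul_mem b hv)
  have hnorm : ∀ h ∈ S, ‖D.toLp h‖ ≤ R := by
    intro h hh
    refine hR h ?_ ?_
    · filter_upwards [hh.2] with t ht
      rw [abs_of_nonneg ht.1]
      exact ht.2
    · filter_upwards [hfW, fn_eq_zero_of_mem_F0 hh.1, D.fn_sub f h] with t a b c ht
      have h1 := b ht
      rw [c, a ht] at h1
      linarith
  let I : Set ℝ := (fun h => D.E h h) '' S
  have hIne : I.Nonempty := ⟨_, f, hfS, rfl⟩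
  have hIb : BddBelow I := ⟨0, by rintro _ ⟨h, -, rfl⟩; exact D.E_nonneg h⟩
  have hex : ∀ n : ℕ, ∃ h ∈ S, D.E h h < sInf I + 1 / (n + 1) := by
    intro n
    obtain ⟨_, ⟨h, hh, rfl⟩, hlt⟩ := exists_lt_of_csInf_lt hIne
      (show sInf I < sInf I + 1 / (n + 1) from lt_add_of_pos_right _ Nat.one_div_pos_of_nat)
    exact ⟨h, hh, hlt⟩
  choose x hxS hxE using hex
  have hlim : Tendsto (fun n : ℕ => sInf I + 1 / ((n : ℝ) + 1)) atTop (𝓝 (sInf I)) := by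
    simpa using tendsto_one_div_add_atTop_nhds_zero_nat.const_add (sInf I)
  have hbound : ∀ h ∈ S, ∀ a : ℝ, D.E h h ≤ a → ‖h‖ ≤ √(a + R ^ 2) := by
    intro h hh a ha
    refine Real.le_sqrt_of_sq_le ?_
    rw [norm_sq]
    have := pow_le_pow_left₀ (norm_nonneg _) (hnorm h hh) 2
    linarith
  obtain ⟨y, hy⟩ := exists_mem_of_eventually_mem_closed_convex x (√(sInf I + 1 + R ^ 2)) fun n =>
    hbound _ (hxS n) _ ((hxE n).le.trans (by
      have : (1 : ℝ) / (n + 1) ≤ 1 := by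
        rw [div_le_one (by positivity)]
        linarith [(Nat.cast_nonneg n : (0 : ℝ) ≤ n)]
      linarith))
  have hyS : y ∈ S := hy S hclosed hconv (Eventually.of_forall hxS)
  have hyE : D.E y y ≤ sInf I := by
    refine le_of_forall_gt_imp_ge_of_dense fun a ha => ?_
    refine hy _ (D.isClosed_E_le a) (D.convex_E_le a) ?_
    filter_upwards [hlim.eventually_lt_const ha] with n hn using ((hxE n).trans hn).le
  have hmin : ∀ h ∈ S, D.E y y ≤ D.E h h := fun h hh => hyE.trans (csInf_le hIb ⟨h, hh, rfl⟩)
  -- The constraint `0 ≤ h ≤ M` costs nothing: clipping `y + ψ` to `[0, M]` does not increase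
  -- energy, and moves `y` by at most `|ψ|`, hence within `F0 W` by solidity.
  have hvar : ∀ ψ ∈ D.F0 W, D.E y y ≤ D.E (y + ψ) (y + ψ) := by
    intro ψ hψ
    refine (hmin (D.trunc M (y + ψ)) ⟨?_, ?_⟩).trans (D.E_trunc_le hM _)
    · have h1 : y - D.trunc M (y + ψ) ∈ D.F0 W := by
        refine mem_F0_of_abs_le hreg hψ ?_
        filter_upwards [D.fn_sub y (D.trunc M (y + ψ)), D.fn_trunc hM (y + ψ), D.fn_add y ψ, hyS.2]
          with t a b c d
        have h2 : D.fn y t = min (max 0 (D.fn y t)) M := by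
          rw [max_eq_right d.1, min_eq_left d.2]
        rw [a, b, c]
        nth_rewrite 1 [h2]
        refine (abs_min_sub_min_le_max _ _ _ _).trans (max_le ?_ (by simp))
        refine (abs_max_zero_sub_le _ _).trans (le_of_eq ?_)
        rw [sub_add_cancel_left, abs_neg]
      have h3 := add_mem hyS.1 h1
      rwa [sub_add_sub_cancel] at h3
    · filter_upwards [D.fn_trunc hM (y + ψ)] with t a
      rw [a]
      exact ⟨le_min (le_max_left _ _) hM.le, min_le_right _ _⟩
  refine ⟨y, hyS.1, hyS.2, hbound y hyS _ (hmin f hfS), fun ψ hψ => ?_⟩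
  have key : ∀ t : ℝ, 0 ≤ D.E ψ ψ * (t * t) + 2 * D.E y ψ * t + 0 := by
    intro t
    have h1 := hvar (t • ψ) ((D.F0 W).smul_mem t hψ)
    rw [E_add_self, E_smul_self, map_smul, smul_eq_mul] at h1
    linarith
  have h2 := discrim_le_zero key
  rw [discrim] at h2
  have h3 : D.E y ψ ^ 2 ≤ 0 := by linarith
  exact pow_eq_zero_iff (two_ne_zero) |>.1 (le_antisymm h3 (sq_nonneg _))

end Minimizer

/-! ### Density of bounded harmonic functions -/

section Density

variable {K : Type*} [TopologicalSpace K] [MeasurableSpace K] {μ ν : Measure K}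
  (D : DirichletForm μ) {Λ : ℕ → Type*} (U : (n : ℕ) → Λ n → Set K)

/-- The bounded elements of the domain that are orthogonal, for the form, to `F0 (U n k)`
for all large `n` and all `k`. -/
def boundedHarmonic : Submodule ℝ D.Dom where
  carrier := {h | (∃ N, ∀ n ≥ N, ∀ k : Λ n, ∀ ψ ∈ D.F0 (U n k), D.E h ψ = 0) ∧
    ∃ M : ℝ, ∀ᵐ t ∂μ, |D.fn h t| ≤ M}
  zero_mem' := ⟨⟨0, fun _ _ _ _ _ => by simp⟩, 0, by
    filter_upwards [D.fn_zero] with t ht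
    simp [ht]⟩
  add_mem' := by
    rintro u v ⟨⟨N, hN⟩, M, hM⟩ ⟨⟨N', hN'⟩, M', hM'⟩
    refine ⟨⟨max N N', fun n hn k ψ hψ => ?_⟩, M + M', ?_⟩
    · rw [map_add, LinearMap.add_apply, hN n (le_of_max_le_left hn) k ψ hψ,
        hN' n (le_of_max_le_right hn) k ψ hψ, add_zero]
    · filter_upwards [hM, hM', D.fn_add u v] with t a b c
      rw [c]
      exact (abs_add_le _ _).trans (add_le_add a b)
  smul_mem' := by
    rintro c u ⟨⟨N, hN⟩, M, hM⟩
    refine ⟨⟨N, fun n hn k ψ hψ => ?_⟩, |c| * M, ?_⟩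
    · rw [map_smul, LinearMap.smul_apply, hN n hn k ψ hψ, smul_zero]
    · filter_upwards [hM, D.fn_smul c u] with t a b
      rw [b, abs_mul]
      gcongr

variable {D U} [LocallyCompactSpace K] [T2Space K] [BorelSpace K]

theorem mem_closure_boundedHarmonic_of_nonneg (hreg : D.IsRegular) (hloc : D.IsStronglyLocal)
    (hU : IsCellPartitionSequence μ ν U) {f : D.Dom} (hf : f ∈ D.core univ)
    (hf0 : ∀ᵐ t ∂μ, 0 ≤ D.fn f t) : f ∈ (D.boundedHarmonic U).topologicalClosure := by
  obtain ⟨φ, S, h1, h2, -, h4, h5⟩ := hf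
  obtain ⟨M', hM'⟩ := h2.exists_bound_of_continuousOn h1.continuousOn
  obtain ⟨M, hM, hfM⟩ : ∃ M : ℝ, 0 < M ∧ ∀ᵐ t ∂μ, D.fn f t ∈ Icc 0 M := by
    refine ⟨|M'| + 1, by positivity, ?_⟩
    filter_upwards [hf0, h5] with t a b
    refine ⟨a, ?_⟩
    rw [b]
    by_cases ht : t ∈ S
    · have := (le_abs_self _).trans (hM' t ht)
      linarith [le_abs_self M']
    · rw [h4 t ht]
      positivity
  have hfS : ∀ᵐ t ∂μ, t ∉ S → D.fn f t = 0 := by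
    filter_upwards [h5] with t ht htS
    rw [ht, h4 t htS]
  have hfW : ∀ n, ∀ᵐ t ∂μ, t ∉ cellUnion U S n → D.fn f t = 0 := by
    intro n
    have h0 : μ (⋃ k, U n k)ᶜ = 0 := by
      have := (hU.partition n).null_compl
      rw [Measure.add_apply] at this
      exact (add_eq_zero.1 this).1
    filter_upwards [hfS, measure_eq_zero_iff_ae_notMem.1 h0] with t a b ht
    refine a fun htS => ht ?_
    obtain ⟨k, hk⟩ := mem_iUnion.1 (not_not.1 b)
    exact mem_cellUnion.2 ⟨k, ⟨t, hk, htS⟩, hk⟩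
  obtain ⟨N, hN⟩ := hU.finite S h2
  obtain ⟨R, hR⟩ := exists_norm_toLp_le (D := D) (isOpen_cellUnion hU S N).measurableSet hN M
  -- Starting at the level `N` of finite measure makes `R`, and with it the norm bound, independent
  -- of `n`.
  have hex : ∀ n : ℕ, ∃ h : D.Dom, f - h ∈ D.F0 (cellUnion U S (N + n)) ∧
      (∀ᵐ t ∂μ, D.fn h t ∈ Icc 0 M) ∧ ‖h‖ ≤ √(D.E f f + R ^ 2) ∧
        ∀ ψ ∈ D.F0 (cellUnion U S (N + n)), D.E h ψ = 0 := fun n =>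
    exists_minimizer hreg hM hfM (hfW _) fun h hhM hh0 => hR h hhM (by
      filter_upwards [hh0] with t a ht
      exact a fun h' => ht (cellUnion_anti hU S (Nat.le_add_right N n) h'))
  choose h hhW hhM hhn hhE using hex
  have hhL : ∀ n, h n ∈ D.boundedHarmonic U := by
    intro n
    have hcell : ∀ k : Λ (N + n), ∀ ψ ∈ D.F0 (U (N + n) k), D.E (h n) ψ = 0 := by
      intro k ψ hψ
      by_cases hk : (U (N + n) k ∩ S).Nonempty
      · exact hhE n ψ (F0_mono (fun t ht => mem_cellUnion.2 ⟨k, hk, ht⟩) hψ)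
      -- On a cell that misses `S`, both `f` and `f - h n` vanish, so `h n` does, and strong
      -- locality applies.
      · rw [E_comm]
        refine E_eq_zero_of_mem_F0 hloc ((hU.partition _).isOpen k) hψ ?_
        filter_upwards [hfS, fn_eq_zero_of_mem_F0 (hhW n), D.fn_sub f (h n)] with t a b c ht
        have h6 : t ∉ S := fun htS => hk ⟨t, ht, htS⟩
        have h7 : t ∉ cellUnion U S (N + n) := by
          intro h'
          obtain ⟨l, hl, htl⟩ := mem_cellUnion.1 h'
          by_cases hlk : l = k
          · exact hk (hlk ▸ hl)
          · exact ((hU.partition _).disjoint l k hlk).le_bot ⟨htl, ht⟩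
        have h8 := b h7
        rw [c, a h6] at h8
        linarith
    refine ⟨⟨N + n, fun m hm k ψ hψ => ?_⟩, M, ?_⟩
    · obtain ⟨k', hk'⟩ := exists_cell_superset hU hm k
      exact hcell k' ψ (F0_mono hk' hψ)
    · filter_upwards [hhM n] with t a
      rw [abs_of_nonneg a.1]
      exact a.2
  obtain ⟨y, hy⟩ := exists_mem_of_eventually_mem_closed_convex h _ hhn
  have hyL : y ∈ (D.boundedHarmonic U).topologicalClosure :=
    hy _ (Submodule.isClosed_topologicalClosure _)
      (D.boundedHarmonic U).topologicalClosure.convex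
      (Eventually.of_forall fun n => Submodule.le_topologicalClosure _ (hhL n))
  have hyM : ∀ᵐ t ∂μ, D.fn y t ∈ Icc 0 M :=
    hy _ (D.isClosed_ae_mem _ fun _ => isClosed_Icc) (D.convex_ae_mem _ fun _ => convex_Icc 0 M)
      (Eventually.of_forall hhM)
  -- For fixed `n`, all later `f - h m` lie in `F0 (cellUnion U S n)`, a condition closed and convex
  -- in `h m`.
  have hyV : f - y ∈ D.nullSpace U S := by
    rw [mem_nullSpace]
    intro n
    refine hy {z | f - z ∈ D.F0 (cellUnion U S n)}
      ((isClosed_F0 _).preimage (continuous_const.sub continuous_id)) ?_ ?_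
    · intro u hu v hv a b ha hb hab
      have h1 : f - (a • u + b • v) = a • (f - u) + b • (f - v) := by
        rw [show b = 1 - a by linarith]
        module
      change f - (a • u + b • v) ∈ D.F0 (cellUnion U S n)
      rw [h1]
      exact add_mem (Submodule.smul_mem _ a hu) (Submodule.smul_mem _ b hv)
    · filter_upwards [eventually_ge_atTop n] with m hm
      exact F0_mono (cellUnion_anti hU S (hm.trans (Nat.le_add_left m N))) (hhW m)
  have hgM : ∀ᵐ t ∂μ, |D.fn (f - y) t| ≤ M := by
    filter_upwards [hfM, hyM, D.fn_sub f y] with t a b c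
    rw [c, abs_le]
    constructor <;> linarith [a.1, a.2, b.1, b.2]
  have hgE : ∀ w, D.E (f - y) w = 0 :=
    E_bounded_eq_zero hreg hloc (fun A hA => reflectionInvariant_nullSpace hreg hloc hU S hA)
      (fun u hu v hv => mem_nullSpace.2 fun n => mem_F0_of_abs_le hreg (mem_nullSpace.1 hu n) hv)
      hyV hM hgM
  -- Having no energy, the defect is orthogonal to everything, hence harmonic from level `0` on.
  have hgL : f - y ∈ D.boundedHarmonic U := ⟨⟨0, fun _ _ _ ψ _ => hgE ψ⟩, M, hgM⟩
  have := add_mem (Submodule.le_topologicalClosure _ hgL) hyL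
  rwa [sub_add_cancel] at this

theorem mem_closure_boundedHarmonic (hreg : D.IsRegular) (hloc : D.IsStronglyLocal)
    (hU : IsCellPartitionSequence μ ν U) (f : D.Dom) :
    f ∈ (D.boundedHarmonic U).topologicalClosure := by
  have hpos : ∀ u ∈ D.core univ, D.pos u ∈ (D.boundedHarmonic U).topologicalClosure := by
    intro u hu
    refine mem_closure_boundedHarmonic_of_nonneg hreg hloc hU (pos_mem_core hu) ?_
    filter_upwards [D.fn_pos u] with t a
    rw [a]
    exact le_max_left _ _
  refine Submodule.topologicalClosure_minimal (D.core univ) (fun u hu => ?_)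
    (Submodule.isClosed_topologicalClosure _) (mem_F0_univ hreg f)
  rw [← D.pos_sub_pos_neg u]
  exact sub_mem (hpos u hu) (hpos (-u) (neg_mem hu))

end Density

end DirichletForm

theorem proposition3 {K : Type*} [TopologicalSpace K] [LocallyCompactSpace K]
    [TopologicalSpace.SeparableSpace K] [TopologicalSpace.MetrizableSpace K]
    [MeasurableSpace K] [BorelSpace K]
    (μ : Measure K) [μ.Regular] [μ.IsOpenPosMeasure]
    (D : DirichletForm μ) (hreg : D.IsRegular) (hloc : D.IsStronglyLocal)
    (ν : Measure K) (hν : D.IsMinimalEnergyDominant ν)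
    {Λ : ℕ → Type*} (U : (n : ℕ) → Λ n → Set K) (hU : IsCellPartitionSequence μ ν U) :
    D.IsDense (D.harmonicStar U ∩ {h | MemLp (D.rep h) ∞ μ}) := by
  suffices H : ∀ f : D.Dom, ∀ ε : ℝ, 0 < ε → ∃ g : D.Dom,
      ((∃ n, ∀ k : Λ n, D.IsHarmonicOn g (U n k)) ∧ MemLp (D.fn g) ∞ μ) ∧
        √(D.normSq (f - g : D.Dom)) < ε by
    intro f ε hε
    obtain ⟨g, ⟨⟨n, hn⟩, hg⟩, hfg⟩ := H f ε hε
    exact ⟨g, ⟨mem_iUnion.2 ⟨n, hn⟩, hg⟩, hfg⟩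
  intro f ε hε
  obtain ⟨g, ⟨⟨N, hN⟩, M, hM⟩, hfg⟩ := Metric.mem_closure_iff.1
    (DirichletForm.mem_closure_boundedHarmonic hreg hloc hU f) ε hε
  refine ⟨g, ⟨⟨N, fun k => ?_⟩, ?_⟩, ?_⟩
  · exact DirichletForm.isHarmonicOn_of_E_eq_zero hreg ((hU.partition N).isOpen k)
      (hN N le_rfl k)
  · exact memLp_top_of_bound (D.aestronglyMeasurable_fn g) M hM
  · rwa [DirichletForm.normSq_eq, Real.sqrt_sq (norm_nonneg _), ← dist_eq_norm]
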